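/- Let $n,m$ be natural numbers, $[n]=\{1,\dots,n\}$, and let $f_1,\dots,f_n:\mathbb{R}^m\to\mathbb{R}$, $F=\sum_{i=1}^n f_i$. Let $\|\cdot\|$ be the $\ell_\infty$ norm, and call $g\in\mathbb{R}^m$ a subgradient of $f_i$ at $z$ if $f_i(y)-f_i(z)\ge\langle g,y-z\rangle$ for all $y\in\mathbb{R}^m$. Let $(\Omega,\mathcal{F},\Pr)$ be a probability space with a filtration $\{\mathcal{F}(t)\}_{t\ge 0}$, let $t_0\ge 1$ be an integer, let $\{W(t)\}$ be random $n\times n$ matrices adapted to $\{\mathcal{F}(t)\}$, and fix $0<\gamma<1$. For a matrix $A=[a_{ij}]$ let $\mathcal{E}(A)=\{(j,i): a_{ij}>\gamma\}$, and say that a directed graph on $[n]$ has a spanning rooted tree if it has a vertex from which there is a directed path to every other vertex. Assume: 1. (Objectives) Each $f_i$ is convex; the set $\mathcal{Z}=\arg\min_{z\in\mathbb{R}^m}F(z)$ is nonempty; and there are constants $L_i$ such that $\|g\|\le L_i$ for every $z\in\mathbb{R}^m$, every $i$ and every subgradient $g$ of $f_i$ at $z$. 2. (Stochasticity) For every $t\ge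 t_0$, $W(t)$ is almost surely row-stochastic (nonnegative entries, row sums $1$); for every $t>t_0$, $\mathbb{E}[W(t)\mid\mathcal{F}(t-1)]$ is almost surely column-stochastic (nonnegative entries, column sums $1$). 3. (Conditional $B$-connectivity) For every $t\ge t_0$, almost surely $w_{ii}(t)>\gamma$ for all $i\in[n]$; and there is an integer $B>0$ such that for every $t\ge t_0$ the random directed graph on $[n]$ with edge set $$\bigcup_{\tau=tB+1}^{(t+1)B}\mathcal{E}\big(\mathbb{E}[W(\tau)\mid\mathcal{F}(tB)]\big)$$ almost surely has a spanning rooted tree. 4. (Step-sizes) There are $K,\beta>0$ with $0<\alpha(t)\le Kt^{-\beta}$ for all $t\ge t_0$; $\lim_{t\to\infty}\alpha(t)/\alpha(t+1)=1$; $\sum_{t=t_0}^\infty\alpha(t)=\infty$; and $\sum_{t=t_0}^\infty\alpha(t)^2<\infty$. Given deterministic initial conditions $\mathbf{x}_i(t_0)\in\mathbb{R}^m$, $i\in[n]$, consider the dynamics $$\mathbf{x}_i(t+1)=\sum_{j=1}^n w_{ij}(t+1)\,\mathbf{x}_j(t)-\alpha(t)\,\mathbf{g}_i(t),\qquad t\ge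 t_0,\ i\in[n],$$ where $\mathbf{g}_i(t)$ is an $\mathcal{F}(t)$-measurable subgradient of $f_i$ at $\mathbf{x}_i(t)$. Then, for all initial conditions and every such trajectory, there is a random vector $z^*$ with $z^*\in\mathcal{Z}$ almost surely such that, almost surely, $\lim_{t\to\infty}\mathbf{x}_i(t)=z^*$ for all $i\in[n]$. -/

import Mathlib

open MeasureTheory Filter Topology
open scoped BigOperators

noncomputable section

namespace DistOpt

/-- The `ℓ∞` norm of a vector of `ℝᵐ`. -/
def supNorm {m : ℕ} (v : EuclideanSpace ℝ (Fin m)) : ℝ := ‖WithLp.ofLp v‖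

/-- The set of all subgradients of `f` at `z`. -/
def subgradients {m : ℕ} (f : EuclideanSpace ℝ (Fin m) → ℝ) (z : EuclideanSpace ℝ (Fin m)) :
    Set (EuclideanSpace ℝ (Fin m)) :=
  {g | ∀ y, inner ℝ g (y - z) ≤ f y - f z}

/-- The global objective `F = ∑ᵢ fᵢ`. -/
def totalCost {n m : ℕ} (f : Fin n → EuclideanSpace ℝ (Fin m) → ℝ)
    (z : EuclideanSpace ℝ (Fin m)) : ℝ :=
  ∑ i, f i z

/-- The set of global minimizers of `F = ∑ᵢ fᵢ`. -/
def optimalSet {n m : ℕ} (f : Fin n → EuclideanSpace ℝ (Fin m) → ℝ) :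
    Set (EuclideanSpace ℝ (Fin m)) :=
  {z | ∀ y, totalCost f z ≤ totalCost f y}

/-- The directed graph with threshold `γ` of a matrix: there is an edge from `j` to `i` exactly
when `γ < A i j`. -/
def thresholdGraph {n : ℕ} (γ : ℝ) (A : Matrix (Fin n) (Fin n) ℝ) : Digraph (Fin n) where
  Adj j i := γ < A i j

/-- A directed graph has a spanning rooted tree: some vertex, a root, has a directed path to every
vertex. -/
def HasSpanningRootedTree {V : Type*} (G : Digraph V) : Prop :=
  ∃ r : V, ∀ v : V, Relation.ReflTransGen G.Adj r v

/-- Entrywise conditional expectation of a random matrix. -/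
def condExpMatrix {n : ℕ} {Ω : Type*} [mΩ : MeasurableSpace Ω] (μ : Measure Ω)
    (𝒢 : MeasurableSpace Ω) (A : Ω → Matrix (Fin n) (Fin n) ℝ) (ω : Ω) :
    Matrix (Fin n) (Fin n) ℝ :=
  Matrix.of fun i j => (μ[fun ω' => A ω' i j | 𝒢]) ω

/-- The random graph whose edge set is the union, over `t B + 1 ≤ τ ≤ (t + 1) B`, of the edge sets
of the threshold graphs of `𝔼[W(τ) | ℱ(t B)]`. -/
def blockGraph {n : ℕ} {Ω : Type*} [mΩ : MeasurableSpace Ω] (μ : Measure Ω)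
    (ℱ : Filtration ℕ mΩ) (W : ℕ → Ω → Matrix (Fin n) (Fin n) ℝ) (γ : ℝ) (B t : ℕ) (ω : Ω) :
    Digraph (Fin n) where
  Adj j i := ∃ τ ∈ Finset.Icc (t * B + 1) ((t + 1) * B),
    (thresholdGraph γ (condExpMatrix μ (ℱ (t * B)) (W τ) ω)).Adj j i

/-- Convex objectives, a nonempty set of minimizers of their sum, and uniformly bounded
subgradients. -/
structure ObjectiveAssumption {n m : ℕ} (f : Fin n → EuclideanSpace ℝ (Fin m) → ℝ)
    (L : Fin n → ℝ) : Prop where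
  convex : ∀ i, ConvexOn ℝ Set.univ (f i)
  nonempty_optimalSet : (optimalSet f).Nonempty
  subgradient_bound : ∀ i z, ∀ g ∈ subgradients (f i) z, supNorm g ≤ L i

/-- The weight matrices are adapted to `ℱ`, almost surely row-stochastic, and column-stochastic in
conditional expectation given the preceding σ-algebra. -/
structure StochasticAssumption {n : ℕ} {Ω : Type*} [mΩ : MeasurableSpace Ω] (μ : Measure Ω)
    (ℱ : Filtration ℕ mΩ) (t₀ : ℕ) (W : ℕ → Ω → Matrix (Fin n) (Fin n) ℝ) : Prop where
  adapted : ∀ t, t₀ ≤ t → ∀ i j, Measurable[ℱ t] fun ω => W t ω i j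
  rowStochastic : ∀ t, t₀ ≤ t → ∀ᵐ ω ∂μ, W t ω ∈ Matrix.rowStochastic ℝ (Fin n)
  colStochastic : ∀ t, t₀ < t →
    ∀ᵐ ω ∂μ, condExpMatrix μ (ℱ (t - 1)) (W t) ω ∈ Matrix.colStochastic ℝ (Fin n)

/-- Conditional `B`-connectivity with self-loops, for the edge threshold `γ`. -/
structure ConnectivityAssumption {n : ℕ} {Ω : Type*} [mΩ : MeasurableSpace Ω] (μ : Measure Ω)
    (ℱ : Filtration ℕ mΩ) (t₀ : ℕ) (W : ℕ → Ω → Matrix (Fin n) (Fin n) ℝ) (γ : ℝ) : Prop where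
  self_loop : ∀ t, t₀ ≤ t → ∀ᵐ ω ∂μ, ∀ i, (thresholdGraph γ (W t ω)).Adj i i
  connected : ∃ B : ℕ, 0 < B ∧ ∀ t, t₀ ≤ t →
    ∀ᵐ ω ∂μ, HasSpanningRootedTree (blockGraph μ ℱ W γ B t ω)

/-- The conditions on the step-sizes `α(t)`, `t ≥ t₀`. -/
structure StepSizeAssumption (t₀ : ℕ) (α : ℕ → ℝ) : Prop where
  pos : ∀ t, t₀ ≤ t → 0 < α t
  bound : ∃ K β : ℝ, 0 < K ∧ 0 < β ∧ ∀ t, t₀ ≤ t → α t ≤ K * (t : ℝ) ^ (-β)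
  ratio : Tendsto (fun t => α t / α (t + 1)) atTop (𝓝 1)
  sum_eq_top : Tendsto (fun T => ∑ t ∈ Finset.Ico t₀ T, α t) atTop atTop
  sum_sq : Summable fun k => α (t₀ + k) ^ 2

/-- `x` is a trajectory of `x(t+1) = W(t+1) x(t) - α(t) g(t)`, `t ≥ t₀`, started at the
deterministic point `x₀`, where `gᵢ(t)` is a subgradient of `fᵢ` at `xᵢ(t)` that is chosen on the
basis of the information `ℱ(t)` available at time `t`. -/
structure IsSubgradientDynamics {n m : ℕ} {Ω : Type*} [mΩ : MeasurableSpace Ω]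
    (ℱ : Filtration ℕ mΩ) (t₀ : ℕ) (f : Fin n → EuclideanSpace ℝ (Fin m) → ℝ)
    (W : ℕ → Ω → Matrix (Fin n) (Fin n) ℝ) (α : ℕ → ℝ)
    (x₀ : Fin n → EuclideanSpace ℝ (Fin m))
    (x g : ℕ → Ω → Fin n → EuclideanSpace ℝ (Fin m)) : Prop where
  initial : ∀ ω i, x t₀ ω i = x₀ i
  subgradient : ∀ t, t₀ ≤ t → ∀ ω i, g t ω i ∈ subgradients (f i) (x t ω i)
  adapted : ∀ t, t₀ ≤ t → ∀ i, Measurable[ℱ t] fun ω => g t ω i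
  step : ∀ t, t₀ ≤ t → ∀ ω i,
    x (t + 1) ω i = ∑ j, W (t + 1) ω i j • x t ω j - α t • g t ω i

end DistOpt

end

/-! Two quantities drive the proof: the dispersion `disp` of the agents around their average, and
the sum of squared distances to a minimizer `z`.

Rows summing to one make mixing a convex combination, and conditional column sums of one keep the
sum of squared distances to any point known at time `t` from growing in mean. Self-loops improve
this to a strict decrease by a multiple of `edgeEnergy` (`StochasticAssumption.setIntegral_mix_le`).
A single step may leave the dispersion untouched, but the rooted tree of a block bounds the
dispersion at its start by the energy spent during the block (`integral_disp_block_le`). Hence the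
expected dispersion contracts from block to block up to terms of order `α ^ 2`, and is summable
(`summable_integral_disp`).

The subgradient inequality then makes the squared distance to `z` an almost supermartingale with
perturbation of order `α ^ 2 + disp` and gain `2 α (F(avg) - F(z))`. By `robbins_siegmund` the
distances converge and the weighted gaps are summable (`ae_fejer`). Since `∑ α = ∞`, the averages
have a minimizer as a cluster point, and convergence of the distances to a countable dense set of
minimizers makes it the limit (`exists_tendsto_minimizer`). -/

namespace DistOpt

/-! ### Dispersion, convex combinations and rooted trees. -/

section Deterministic

variable {ι E : Type*} [Fintype ι] [NormedAddCommGroup E]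

/-- The bound across an edge is symmetric, so directions can be forgotten; a simple path in the
resulting undirected graph has fewer than `card ι` edges. -/
lemma norm_sub_le_of_spanningRootedTree {G : Digraph ι} {x : ι → E} {δ : ℝ}
    (hδ : 0 ≤ δ) (hx : ∀ j i, G.Adj j i → ‖x i - x j‖ ≤ δ) {r : ι}
    (hr : ∀ v, Relation.ReflTransGen G.Adj r v) (v : ι) :
    ‖x v - x r‖ ≤ Fintype.card ι * δ := by
  let H : SimpleGraph ι := SimpleGraph.fromRel G.Adj
  have hreach : H.Reachable v r := by
    induction hr v with
    | refl => exact SimpleGraph.Reachable.refl _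
    | @tail b c _ hbc ih =>
      by_cases h : c = b
      · rw [h]; exact ih
      · exact (SimpleGraph.Adj.reachable
          ((SimpleGraph.fromRel_adj _ _ _).2 ⟨h, Or.inr hbc⟩)).trans ih
  have hadj : ∀ a b, H.Adj a b → ‖x a - x b‖ ≤ δ := by
    intro a b hab
    rcases ((SimpleGraph.fromRel_adj _ _ _).1 hab).2 with h | h
    · rw [norm_sub_rev]; exact hx _ _ h
    · exact hx _ _ h
  have hwalk : ∀ {a b : ι} (p : H.Walk a b), ‖x a - x b‖ ≤ p.length * δ := by
    intro a b p
    induction p with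
    | nil => simp
    | @cons a b c hab p ih =>
      have := norm_sub_le_norm_sub_add_norm_sub (x a) (x b) (x c)
      have := hadj _ _ hab
      rw [SimpleGraph.Walk.length_cons]; push_cast; linarith
  obtain ⟨p, hp⟩ := hreach.exists_isPath
  refine (hwalk p).trans ?_
  gcongr
  exact hp.length_lt.le

lemma norm_sub_sq_le_eps {ε : ℝ} (hε : 0 < ε) (a b : E) :
    ‖a - b‖ ^ 2 ≤ (1 + ε) * ‖a‖ ^ 2 + (1 + ε⁻¹) * ‖b‖ ^ 2 := by
  have h1 : ‖a - b‖ ^ 2 ≤ (‖a‖ + ‖b‖) ^ 2 := by gcongr; exact norm_sub_le _ _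
  have h2 : 2 * (‖a‖ * ‖b‖) ≤ ε * ‖a‖ ^ 2 + ε⁻¹ * ‖b‖ ^ 2 := by
    have h := sq_nonneg (ε * ‖a‖ - ‖b‖)
    have h3 : 0 ≤ ε⁻¹ * (ε * ‖a‖ - ‖b‖) ^ 2 := by positivity
    have h4 : ε⁻¹ * (ε * ‖a‖ - ‖b‖) ^ 2
      = ε * ‖a‖ ^ 2 + ε⁻¹ * ‖b‖ ^ 2 - 2 * (‖a‖ * ‖b‖) := by field_simp; ring
    linarith
  nlinarith

variable [InnerProductSpace ℝ E]

/-- The average of a finite family of vectors. -/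
noncomputable def avg (x : ι → E) : E := (Fintype.card ι : ℝ)⁻¹ • ∑ i, x i

/-- The dispersion of a finite family of vectors around its average. -/
noncomputable def disp (x : ι → E) : ℝ := ∑ i, ‖x i - avg x‖ ^ 2

lemma disp_nonneg (x : ι → E) : 0 ≤ disp x := Finset.sum_nonneg fun _ _ => sq_nonneg _

lemma continuous_avg : Continuous (avg : (ι → E) → E) := by
  unfold avg; fun_prop

lemma continuous_disp : Continuous (disp : (ι → E) → ℝ) := by
  have := continuous_avg (ι := ι) (E := E)
  unfold disp; fun_prop

/-- Bias–variance decomposition: the cross term vanishes because the deviations from the weighted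
mean have weighted sum zero. -/
lemma sum_mul_norm_sub_sq {w : ι → ℝ} (hw : ∑ j, w j = 1) (x : ι → E) (c : E) :
    ∑ j, w j * ‖x j - c‖ ^ 2 = ‖(∑ j, w j • x j) - c‖ ^ 2
      + ∑ j, w j * ‖x j - ∑ k, w k • x k‖ ^ 2 := by
  set a := ∑ j, w j • x j with ha
  have h0 : ∑ j, w j * inner ℝ (x j - a) (a - c) = 0 := by
    have : ∑ j, w j * inner ℝ (x j - a) (a - c) = inner ℝ (∑ j, w j • (x j - a)) (a - c) := by
      rw [sum_inner]; simp [inner_smul_left]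
    rw [this]
    simp [smul_sub, Finset.sum_sub_distrib, ← Finset.sum_smul, hw, ← ha]
  have h1 : ∀ j, w j * ‖x j - c‖ ^ 2 = w j * ‖x j - a‖ ^ 2
      + 2 * (w j * inner ℝ (x j - a) (a - c)) + w j * ‖a - c‖ ^ 2 := by
    intro j
    have : x j - c = (x j - a) + (a - c) := by abel
    rw [this, norm_add_sq_real]; ring
  rw [Finset.sum_congr rfl fun j _ => h1 j, Finset.sum_add_distrib, Finset.sum_add_distrib,
    ← Finset.mul_sum, h0, ← Finset.sum_mul, hw]
  ring

/-- The variance `v` around the mean `a` is what convexity gains. The self-weight gives `γ ‖x i - a‖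
^ 2 ≤ v`, so moving the centre from `a` to `x i` costs at most a factor of order `γ⁻¹`. -/
lemma norm_weighted_sub_sq_add_le {w : ι → ℝ} (hw0 : ∀ j, 0 ≤ w j) (hw : ∑ j, w j = 1)
    {γ : ℝ} (hγ1 : γ ≤ 1) {i : ι} (hi : γ ≤ w i) (x : ι → E) (c : E) :
    ‖(∑ j, w j • x j) - c‖ ^ 2 + γ / 4 * ∑ j, w j * ‖x j - x i‖ ^ 2
      ≤ ∑ j, w j * ‖x j - c‖ ^ 2 := by
  rw [sum_mul_norm_sub_sq hw x c]
  set a := ∑ j, w j • x j with ha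
  set v := ∑ j, w j * ‖x j - a‖ ^ 2 with hv
  have hvi : γ * ‖x i - a‖ ^ 2 ≤ v := by
    calc γ * ‖x i - a‖ ^ 2 ≤ w i * ‖x i - a‖ ^ 2 := by gcongr
      _ ≤ v := Finset.single_le_sum (f := fun j => w j * ‖x j - a‖ ^ 2)
        (fun j _ => mul_nonneg (hw0 j) (sq_nonneg _)) (Finset.mem_univ i)
  have hv0 : 0 ≤ v := Finset.sum_nonneg fun j _ => mul_nonneg (hw0 j) (sq_nonneg _)
  have h1 : ∑ j, w j * ‖x j - x i‖ ^ 2 = v + ‖x i - a‖ ^ 2 := by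
    rw [sum_mul_norm_sub_sq hw x (x i), ← ha, norm_sub_rev]; ring
  rw [h1]
  nlinarith

lemma norm_weighted_sub_sq_le {w : ι → ℝ} (hw0 : ∀ j, 0 ≤ w j) (hw : ∑ j, w j = 1)
    (x : ι → E) (c : E) :
    ‖(∑ j, w j • x j) - c‖ ^ 2 ≤ ∑ j, w j * ‖x j - c‖ ^ 2 := by
  rw [sum_mul_norm_sub_sq hw x c]
  have : 0 ≤ ∑ j, w j * ‖x j - ∑ k, w k • x k‖ ^ 2 :=
    Finset.sum_nonneg fun j _ => mul_nonneg (hw0 j) (sq_nonneg _)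
  linarith

lemma avg_eq_sum (x : ι → E) : avg x = ∑ i, (Fintype.card ι : ℝ)⁻¹ • x i := by
  rw [avg, Finset.smul_sum]

lemma sum_norm_sub_sq_eq [Nonempty ι] (x : ι → E) (c : E) :
    ∑ i, ‖x i - c‖ ^ 2 = disp x + Fintype.card ι * ‖avg x - c‖ ^ 2 := by
  have hn : (Fintype.card ι : ℝ) ≠ 0 := by exact_mod_cast Fintype.card_ne_zero
  have h := sum_mul_norm_sub_sq (w := fun _ : ι => (Fintype.card ι : ℝ)⁻¹) (by simp [hn]) x c
  rw [← avg_eq_sum, ← Finset.mul_sum, ← Finset.mul_sum] at h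
  rw [inv_mul_eq_iff_eq_mul₀ hn] at h
  rw [h, disp]
  field_simp
  ring

/-- The average minimizes the sum of squares, so any convenient centre, such as the previous
average, may replace it. -/
lemma disp_le [Nonempty ι] (x : ι → E) (c : E) : disp x ≤ ∑ i, ‖x i - c‖ ^ 2 := by
  rw [sum_norm_sub_sq_eq]
  exact le_add_of_nonneg_right (by positivity)

lemma norm_sub_avg_sq_le (x : ι → E) (i : ι) : ‖x i - avg x‖ ^ 2 ≤ disp x :=
  Finset.single_le_sum (f := fun i => ‖x i - avg x‖ ^ 2) (fun _ _ => sq_nonneg _)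
    (Finset.mem_univ i)

lemma norm_sub_sq_le_disp (x : ι → E) (i j : ι) : ‖x i - x j‖ ^ 2 ≤ 4 * disp x := by
  have h : ‖x i - x j‖ ≤ ‖x i - avg x‖ + ‖x j - avg x‖ := by
    rw [norm_sub_rev (x j)]; exact norm_sub_le_norm_sub_add_norm_sub _ _ _
  have h2 : ‖x i - x j‖ ^ 2 ≤ (‖x i - avg x‖ + ‖x j - avg x‖) ^ 2 := by gcongr
  nlinarith [norm_sub_avg_sq_le x i, norm_sub_avg_sq_le x j,
    sq_nonneg (‖x i - avg x‖ - ‖x j - avg x‖)]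

lemma disp_le_of_spanningRootedTree [Nonempty ι] {G : Digraph ι} (hG : HasSpanningRootedTree G)
    {x : ι → E} {e : ℝ} (he : 0 ≤ e) (hx : ∀ j i, G.Adj j i → ‖x i - x j‖ ^ 2 ≤ e) :
    disp x ≤ (Fintype.card ι : ℝ) ^ 3 * e := by
  obtain ⟨r, hr⟩ := hG
  refine (disp_le x (x r)).trans ?_
  have h : ∀ i, ‖x i - x r‖ ^ 2 ≤ (Fintype.card ι : ℝ) ^ 2 * e := by
    intro i
    have h1 := norm_sub_le_of_spanningRootedTree (Real.sqrt_nonneg e)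
      (fun j i hji => Real.le_sqrt_of_sq_le (hx j i hji)) hr i
    calc ‖x i - x r‖ ^ 2 ≤ (Fintype.card ι * √e) ^ 2 := by gcongr
      _ = _ := by rw [mul_pow, Real.sq_sqrt he]
  calc ∑ i, ‖x i - x r‖ ^ 2 ≤ ∑ _i : ι, (Fintype.card ι : ℝ) ^ 2 * e :=
        Finset.sum_le_sum fun i _ => h i
    _ = _ := by simp; ring

end Deterministic

/-! ### Existence of subgradients. -/

section Convex

variable {E : Type*} [NormedAddCommGroup E] [InnerProductSpace ℝ E] [FiniteDimensional ℝ E]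

/-- A finite convex function on a finite-dimensional space has a subgradient at every point. -/
lemma exists_subgradient {f : E → ℝ} (hf : ConvexOn ℝ Set.univ f) (z : E) :
    ∃ g : E, ∀ y, inner ℝ g (y - z) ≤ f y - f z := by
  have hc : Continuous f := continuousOn_univ.1 (hf.continuousOn isOpen_univ)
  have hs : Convex ℝ {p : E × ℝ | p.1 ∈ Set.univ ∧ f p.1 < p.2} := hf.convex_strict_epigraph
  have ho : IsOpen {p : E × ℝ | p.1 ∈ Set.univ ∧ f p.1 < p.2} := by
    simp only [Set.mem_univ, true_and]
    exact isOpen_lt (hc.comp continuous_fst) continuous_snd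
  -- Separate the graph point from the open strict epigraph. The vertical slope `c` of the
  -- functional is negative because the epigraph extends upwards; dividing by `-c` yields the
  -- subgradient.
  obtain ⟨φ, hφ⟩ := geometric_hahn_banach_open_point (x := (z, f z)) hs ho (by simp)
  have hsplit : ∀ (y : E) (r : ℝ), φ (y, r) = φ (y, 0) + r * φ (0, 1) := by
    intro y r
    have : ((y, r) : E × ℝ) = (y, 0) + r • (0, 1) := by ext <;> simp
    rw [this, map_add, map_smul, smul_eq_mul]
  set c := φ (0, 1) with hcdef
  have hcneg : c < 0 := by
    have h := hφ (z, f z + 1) (by simp)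
    rw [hsplit z (f z + 1), hsplit z (f z)] at h
    linarith
  let ψ : E →L[ℝ] ℝ := φ.comp (ContinuousLinearMap.inl ℝ E ℝ)
  have hψ : ∀ y, φ (y, 0) = ψ y := fun y => rfl
  refine ⟨(-c)⁻¹ • (InnerProductSpace.toDual ℝ E).symm ψ, fun y => ?_⟩
  rw [inner_smul_left, InnerProductSpace.toDual_symm_apply, map_sub]
  have key : ψ y - ψ z ≤ -c * (f y - f z) := by
    refine le_of_forall_pos_lt_add fun ε hε => ?_
    have h := hφ (y, f y + ε / (-c)) (by
      have : 0 < ε / (-c) := div_pos hε (by linarith)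
      simp only [Set.mem_ofPred_eq, Set.mem_univ, true_and]; linarith)
    rw [hsplit, hsplit z, hψ, hψ] at h
    have : ε / (-c) * c = -ε := by
      rw [div_neg, neg_mul, div_mul_cancel₀ _ hcneg.ne]
    nlinarith
  have hc' : 0 < -c := by linarith
  simp only [conj_trivial]
  rw [inv_mul_le_iff₀ hc']
  exact key

end Convex

/-! ### Summability from contraction over blocks. -/

section Sequences

lemma summable_block {a : ℕ → ℝ} (ha : Summable a) {B : ℕ} (hB : 0 < B) (i : ℕ) :
    Summable fun k => a (k * B + i) :=
  ha.comp_injective fun k l (h : k * B + i = l * B + i) =>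
    Nat.eq_of_mul_eq_mul_right hB (by omega)

lemma summable_of_block {a : ℕ → ℝ} (ha : ∀ t, 0 ≤ a t) {B : ℕ} (hB : 0 < B)
    (h : ∀ i < B, Summable fun k => a (k * B + i)) : Summable a := by
  have : NeZero B := ⟨hB.ne'⟩
  rw [← (Nat.divModEquiv B).symm.summable_iff]
  refine (summable_prod_of_nonneg fun _ => ha _).2 ⟨fun k => Summable.of_finite, ?_⟩
  simp only [tsum_fintype, Nat.divModEquiv_symm_apply]
  exact summable_sum fun i _ => h i i.2

/-- Summing the recursion bounds `(1 - q) ∑ u` directly, without iterating powers of `q`; hence `q`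
may be negative. -/
lemma summable_of_succ_le_mul_add {u b : ℕ → ℝ} {q : ℝ} (hq : q < 1) (hu : ∀ k, 0 ≤ u k)
    (hb0 : ∀ k, 0 ≤ b k) (hb : Summable b) (h : ∀ k, u (k + 1) ≤ q * u k + b k) :
    Summable u := by
  refine summable_of_sum_range_le (c := (u 0 + ∑' k, b k) / (1 - q)) hu fun K => ?_
  rw [le_div_iff₀ (by linarith)]
  have h1 : ∀ K, (∑ k ∈ Finset.range K, u k) * (1 - q) + u K
      ≤ u 0 + ∑ k ∈ Finset.range K, b k := by
    intro K
    induction K with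
    | zero => simp
    | succ K ih =>
      rw [Finset.sum_range_succ, Finset.sum_range_succ]
      have := h K
      linarith
  have h2 := hb.sum_le_tsum (Finset.range K) (fun k _ => hb0 k)
  have := h1 K
  have := hu K
  linarith

/-- A nonnegative sequence that contracts over blocks, up to a summable perturbation, is
summable. The decrease `S` of a single step controls the sequence only after summation over
a block. -/
lemma summable_of_block_contraction {U S a : ℕ → ℝ} (hU : ∀ t, 0 ≤ U t) (hS : ∀ t, 0 ≤ S t)
    (ha : ∀ t, 0 ≤ a t) (hsum : Summable a) {B k₀ : ℕ} (hB : 0 < B) {κ C₁ C₂ : ℝ}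
    (hκ : 0 < κ) (hC₁ : 0 ≤ C₁)
    (hstep : ∀ ε : ℝ, 0 < ε → ∃ C : ℝ, 0 ≤ C ∧
      ∀ t, k₀ * B ≤ t → U (t + 1) ≤ (1 + ε) * U t - κ * S t + C * a t)
    (hblock : ∀ k, k₀ ≤ k → U (k * B) ≤ C₁ * ∑ i ∈ Finset.range B, S (k * B + i)
      + C₂ * ∑ i ∈ Finset.range B, a (k * B + i)) :
    Summable U := by
  have hlim : Tendsto (fun ε : ℝ => (1 + ε) ^ B) (𝓝[>] 0) (𝓝 1) := by
    have : Continuous fun ε : ℝ => (1 + ε) ^ B := by fun_prop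
    have h := this.tendsto 0
    simp only [add_zero, one_pow] at h
    exact h.mono_left nhdsWithin_le_nhds
  -- Growth `(1 + ε) ^ B` over a block must stay below the gain `κ / (C₁ + 1)`; the `+ 1` guards
  -- against `C₁ = 0`.
  have hlt : (1 : ℝ) < 1 + κ / (C₁ + 1) := by
    have : 0 < κ / (C₁ + 1) := by positivity
    linarith
  obtain ⟨ε, hε', hε⟩ := ((hlim.eventually_lt_const hlt).and self_mem_nhdsWithin).exists
  have hε : 0 < ε := hε
  obtain ⟨C, hC, hCs⟩ := hstep ε hε
  -- The factors at least `1` that accumulate on the `S` terms are dropped, which is harmless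
  -- because these enter with a minus sign.
  have hiter : ∀ k, k₀ ≤ k → ∀ j, U (k * B + j) ≤ (1 + ε) ^ j * U (k * B)
      - κ * ∑ i ∈ Finset.range j, S (k * B + i)
      + C * (1 + ε) ^ j * ∑ i ∈ Finset.range j, a (k * B + i) := by
    intro k hk j
    induction j with
    | zero => simp
    | succ j ih =>
      have h1 := hCs (k * B + j) ((Nat.mul_le_mul_right B hk).trans (Nat.le_add_right _ _))
      rw [Finset.sum_range_succ, Finset.sum_range_succ]
      set SS := ∑ i ∈ Finset.range j, S (k * B + i)
      set AA := ∑ i ∈ Finset.range j, a (k * B + i)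
      have hSS : 0 ≤ SS := Finset.sum_nonneg fun _ _ => hS _
      have h2 : (1 + ε) * U (k * B + j) ≤ (1 + ε) * ((1 + ε) ^ j * U (k * B) - κ * SS
        + C * (1 + ε) ^ j * AA) := by gcongr
      have h3 : 0 ≤ ε * (κ * SS) := by positivity
      have h4 : C * a (k * B + j) ≤ C * (1 + ε) ^ (j + 1) * a (k * B + j) := by
        have : (1 : ℝ) ≤ (1 + ε) ^ (j + 1) := one_le_pow₀ (by linarith)
        have h5 : C * 1 ≤ C * (1 + ε) ^ (j + 1) := by gcongr
        nlinarith [ha (k * B + j)]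
      have e1 : (1 + ε) * ((1 + ε) ^ j * U (k * B) - κ * SS + C * (1 + ε) ^ j * AA)
        = (1 + ε) ^ (j + 1) * U (k * B) - κ * SS - ε * (κ * SS)
          + C * (1 + ε) ^ (j + 1) * AA := by ring
      rw [← add_assoc]
      linarith
  have hA0 : ∀ k, 0 ≤ ∑ i ∈ Finset.range B, a (k * B + i) :=
    fun k => Finset.sum_nonneg fun _ _ => ha _
  have hA : Summable fun k => ∑ i ∈ Finset.range B, a (k * B + i) :=
    summable_sum fun i _ => summable_block hsum hB i
  set M := |κ / (C₁ + 1) * C₂| + C * (1 + ε) ^ B with hM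
  have hu : Summable fun k => U ((k + k₀) * B) := by
    refine summable_of_succ_le_mul_add (q := (1 + ε) ^ B - κ / (C₁ + 1))
      (b := fun k => M * ∑ i ∈ Finset.range B, a ((k + k₀) * B + i)) (by linarith)
      (fun _ => hU _) (fun k => mul_nonneg (by positivity) (hA0 _))
      (((summable_nat_add_iff k₀).2 hA).mul_left M) fun k => ?_
    have h1 := hiter (k + k₀) (Nat.le_add_left _ _) B
    have h2 := hblock (k + k₀) (Nat.le_add_left _ _)
    have e : (k + 1 + k₀) * B = (k + k₀) * B + B := by ring
    rw [e]
    have hA0' := hA0 (k + k₀)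
    set SS := ∑ i ∈ Finset.range B, S ((k + k₀) * B + i)
    set AA := ∑ i ∈ Finset.range B, a ((k + k₀) * B + i)
    have hSS : 0 ≤ SS := Finset.sum_nonneg fun _ _ => hS _
    have h3 : U ((k + k₀) * B) ≤ (C₁ + 1) * SS + C₂ * AA := by nlinarith
    -- The block decrease `κ * SS` is traded for a fixed fraction of `U` at the start of the block.
    have h4 : κ / (C₁ + 1) * U ((k + k₀) * B) ≤ κ / (C₁ + 1) * ((C₁ + 1) * SS + C₂ * AA) := by
      gcongr
    have e2 : κ / (C₁ + 1) * ((C₁ + 1) * SS + C₂ * AA)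
      = κ * SS + κ / (C₁ + 1) * C₂ * AA := by field_simp
    have h5 : κ / (C₁ + 1) * C₂ * AA ≤ |κ / (C₁ + 1) * C₂| * AA := by
      gcongr; exact le_abs_self _
    have e3 : M * AA = |κ / (C₁ + 1) * C₂| * AA + C * (1 + ε) ^ B * AA := by rw [hM]; ring
    rw [e3, sub_mul]
    linarith
  refine summable_of_block hU hB fun j hj => ?_
  rw [← summable_nat_add_iff k₀]
  refine Summable.of_nonneg_of_le (fun _ => hU _) (fun k => ?_)
    ((hu.mul_left ((1 + ε) ^ j)).add
      (((summable_nat_add_iff k₀).2 hA).mul_left (C * (1 + ε) ^ j)))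
  refine (hiter (k + k₀) (Nat.le_add_left _ _) j).trans ?_
  have h1 : 0 ≤ κ * ∑ i ∈ Finset.range j, S ((k + k₀) * B + i) :=
    mul_nonneg hκ.le (Finset.sum_nonneg fun _ _ => hS _)
  have h2 : ∑ i ∈ Finset.range j, a ((k + k₀) * B + i)
      ≤ ∑ i ∈ Finset.range B, a ((k + k₀) * B + i) :=
    Finset.sum_le_sum_of_subset_of_nonneg (Finset.range_mono hj.le) fun _ _ _ => ha _
  have h3 : C * (1 + ε) ^ j * ∑ i ∈ Finset.range j, a ((k + k₀) * B + i)
    ≤ C * (1 + ε) ^ j * ∑ i ∈ Finset.range B, a ((k + k₀) * B + i) := by gcongr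
  linarith

end Sequences

/-! ### From convergent distances to a limit point. -/

section Convergence

variable {ι E : Type*} [Fintype ι] [Nonempty ι] [NormedAddCommGroup E] [InnerProductSpace ℝ E]

lemma frequently_lt_of_summable_mul {α e : ℕ → ℝ} (hα : ∀ t, 0 < α t) (hα' : ¬ Summable α)
    (h : Summable fun t => α t * e t) {ε : ℝ} (hε : 0 < ε) : ∃ᶠ t in atTop, e t < ε := by
  intro hev
  refine hα' ?_
  obtain ⟨N, hN⟩ := eventually_atTop.1 hev
  rw [← summable_nat_add_iff N]
  refine Summable.of_nonneg_of_le (fun k => (hα _).le) (fun k => ?_)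
    (((summable_nat_add_iff N).2 h).mul_left ε⁻¹)
  have h1 := not_lt.1 (hN (k + N) (Nat.le_add_left _ _))
  rw [← div_eq_inv_mul, le_div_iff₀ hε]
  exact mul_le_mul_of_nonneg_left h1 (hα _).le

/-- Quasi-Fejér monotone sequences with vanishing dispersion converge to a common minimizer. -/
lemma exists_tendsto_minimizer [FiniteDimensional ℝ E] {F : E → ℝ} (hF : Continuous F)
    {Z D : Set E} (hZ : ∀ z, z ∈ Z ↔ ∀ y, F z ≤ F y) (hZne : Z.Nonempty)
    (hD : Z ⊆ closure D) {x : ℕ → ι → E}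
    (hV : ∀ z ∈ D, ∃ l, Tendsto (fun t => ∑ i, ‖x t i - z‖ ^ 2) atTop (𝓝 l))
    (hdisp : Tendsto (fun t => disp (x t)) atTop (𝓝 0)) {α : ℕ → ℝ} (hα : ∀ t, 0 < α t)
    (hα' : ¬ Summable α) {z₀ : E} (hz₀ : z₀ ∈ Z)
    (hsum : Summable fun t => α t * (F (avg (x t)) - F z₀)) :
    ∃ z ∈ Z, ∀ i, Tendsto (fun t => x t i) atTop (𝓝 z) := by
  have : ProperSpace E := FiniteDimensional.proper ℝ E
  have hn : (0 : ℝ) < Fintype.card ι := by exact_mod_cast Fintype.card_pos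
  have havg : ∀ z ∈ D, ∃ r, Tendsto (fun t => ‖avg (x t) - z‖) atTop (𝓝 r) := by
    intro z hz
    obtain ⟨l, hl⟩ := hV z hz
    have h1 := ((hl.sub hdisp).div_const (Fintype.card ι : ℝ)).sqrt
    refine ⟨_, h1.congr fun t => ?_⟩
    rw [sum_norm_sub_sq_eq, add_sub_cancel_left, mul_div_cancel_left₀ _ hn.ne',
      Real.sqrt_sq (norm_nonneg _)]
  have hDne : D.Nonempty := by
    rcases D.eq_empty_or_nonempty with h | h
    · rw [h, closure_empty] at hD
      exact absurd hZne (by simp [Set.subset_empty_iff.1 hD])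
    · exact h
  obtain ⟨z₁, hz₁⟩ := hDne
  obtain ⟨r₁, hr₁⟩ := havg z₁ hz₁
  -- Divergence of `∑ α` forces the gap to be small infinitely often; the averages at these times
  -- are eventually bounded, so they have a cluster point, which minimizes `F`.
  have hfreq : ∀ k : ℕ, ∃ t, k ≤ t ∧ F (avg (x t)) - F z₀ < 1 / ((k : ℝ) + 1) := fun k =>
    ((frequently_lt_of_summable_mul hα hα' hsum (by positivity)).and_eventually
      (eventually_ge_atTop k)).exists.imp fun _ h => ⟨h.2, h.1⟩
  choose τ hτ1 hτ2 using hfreq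
  have hτ : Tendsto τ atTop atTop := tendsto_atTop_mono hτ1 tendsto_id
  have hbdd : ∀ᶠ k in atTop, avg (x (τ k)) ∈ Metric.closedBall z₁ (r₁ + 1) := by
    filter_upwards [(hr₁.comp hτ).eventually_lt_const (lt_add_one r₁)] with k hk
    rw [mem_closedBall_iff_norm]; exact hk.le
  obtain ⟨z, -, φ, hφ, hφz⟩ := (isCompact_closedBall z₁ (r₁ + 1)).tendsto_subseq' hbdd.frequently
  have hzZ : z ∈ Z := by
    rw [hZ]
    have h1 : Tendsto (fun k => F (avg (x (τ (φ k)))) - F z₀) atTop (𝓝 (F z - F z₀)) :=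
      ((hF.tendsto z).comp hφz).sub_const _
    have h2 : Tendsto (fun k => 1 / ((φ k : ℝ) + 1)) atTop (𝓝 0) :=
      tendsto_one_div_add_atTop_nhds_zero_nat.comp hφ.tendsto_atTop
    have h3 := le_of_tendsto_of_tendsto' h1 h2 fun k => (hτ2 (φ k)).le
    intro y
    have := (hZ z₀).1 hz₀ y
    linarith
  have hmain : Tendsto (fun t => avg (x t)) atTop (𝓝 z) := by
    rw [Metric.tendsto_nhds]
    intro ε hε
    -- Distances are only known to converge for points of `D`, so `z` is approximated by `d`. The
    -- subsequence identifies the limit of `‖avg (x t) - d‖` as `‖z - d‖ < ε / 2`, which controls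
    -- all late times.
    obtain ⟨d, hd, hdz⟩ := Metric.mem_closure_iff.1 (hD hzZ) (ε / 2) (by positivity)
    obtain ⟨r, hr⟩ := havg d hd
    have hr' : r = ‖z - d‖ := by
      refine tendsto_nhds_unique (hr.comp (hτ.comp hφ.tendsto_atTop)) ?_
      exact (hφz.sub_const d).norm
    rw [dist_eq_norm] at hdz
    filter_upwards [hr.eventually_lt_const (hr' ▸ hdz)] with t ht
    rw [dist_eq_norm]
    have := norm_sub_le_norm_sub_add_norm_sub (avg (x t)) d z
    rw [norm_sub_rev] at hdz
    linarith
  refine ⟨z, hzZ, fun i => ?_⟩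
  have h1 : Tendsto (fun t => x t i - avg (x t)) atTop (𝓝 0) := by
    rw [tendsto_zero_iff_norm_tendsto_zero]
    have h2 := hdisp.sqrt
    rw [Real.sqrt_zero] at h2
    exact squeeze_zero (fun _ => norm_nonneg _)
      (fun t => Real.le_sqrt_of_sq_le (norm_sub_avg_sq_le (x t) i)) h2
  simpa using h1.add hmain

end Convergence

/-! ### Conditional expectations and almost supermartingales. -/

section Integration

variable {Ω : Type*} [mΩ : MeasurableSpace Ω] {μ : Measure Ω}

/-- Every iterate is essentially bounded, so this supplies the integrability of continuous functions
of the state. -/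
lemma memLp_top_comp_continuous [IsFiniteMeasure μ] {E F : Type*} [NormedAddCommGroup E]
    [ProperSpace E] [NormedAddCommGroup F] {φ : E → F} (hφ : Continuous φ) {u : Ω → E}
    (hu : MemLp u ⊤ μ) : MemLp (fun ω => φ (u ω)) ⊤ μ := by
  obtain ⟨C, hC⟩ := (isCompact_closedBall (0 : E) (eLpNorm u ⊤ μ).toReal).exists_bound_of_continuousOn
    hφ.continuousOn
  refine memLp_top_of_bound (hφ.comp_aestronglyMeasurable hu.1) C ?_
  filter_upwards [ae_le_eLpNormEssSup (f := u) (μ := μ)] with ω hω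
  refine hC _ ?_
  rw [mem_closedBall_zero_iff, ← toReal_enorm]
  refine ENNReal.toReal_mono hu.2.ne ?_
  rwa [eLpNorm_exponent_top]

lemma memLp_top_mul {u v : Ω → ℝ} (hu : MemLp u ⊤ μ) (hv : MemLp v ⊤ μ) :
    MemLp (fun ω => u ω * v ω) ⊤ μ := hv.mul hu

lemma memLp_top_norm_sq {E : Type*} [NormedAddCommGroup E] {u : Ω → E} (hu : MemLp u ⊤ μ) :
    MemLp (fun ω => ‖u ω‖ ^ 2) ⊤ μ := by
  simpa only [sq] using memLp_top_mul hu.norm hu.norm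

lemma memLp_top_integrable [IsFiniteMeasure μ] {u : Ω → ℝ} (hu : MemLp u ⊤ μ) :
    Integrable u μ := hu.integrable le_top

lemma setIntegral_condExp_mul {Ω : Type*} {m' mΩ : MeasurableSpace Ω} {μ : Measure Ω}
    [IsFiniteMeasure μ] (hm : m' ≤ mΩ)
    {X h : Ω → ℝ} (hX : MemLp X ⊤ μ) (hh : StronglyMeasurable[m'] h) (hh' : MemLp h ⊤ μ)
    {A : Set Ω} (hA : MeasurableSet[m'] A) :
    ∫ ω in A, (μ[X | m']) ω * h ω ∂μ = ∫ ω in A, X ω * h ω ∂μ := by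
  have hXh : Integrable (X * h) μ := memLp_top_integrable (memLp_top_mul hX hh')
  have h1 := condExp_mul_of_stronglyMeasurable_right hh hXh (memLp_top_integrable hX)
  have h2 := setIntegral_condExp hm hXh hA
  calc ∫ ω in A, (μ[X | m']) ω * h ω ∂μ = ∫ ω in A, (μ[X * h | m']) ω ∂μ :=
        integral_congr_ae (ae_restrict_of_ae (h1.symm))
    _ = _ := h2

lemma integrable_condExp_mul {Ω : Type*} {m' mΩ : MeasurableSpace Ω} {μ : Measure Ω}
    [IsFiniteMeasure μ] {X h : Ω → ℝ} (hX : MemLp X ⊤ μ) (hh : StronglyMeasurable[m'] h)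
    (hh' : MemLp h ⊤ μ) : Integrable (fun ω => (μ[X | m']) ω * h ω) μ :=
  integrable_condExp.congr (condExp_mul_of_stronglyMeasurable_right hh
    (memLp_top_integrable (memLp_top_mul hX hh')) (memLp_top_integrable hX))

lemma ae_summable_of_summable_integral {h : ℕ → Ω → ℝ} (h0 : ∀ k ω, 0 ≤ h k ω)
    (hi : ∀ k, Integrable (h k) μ) (hs : Summable fun k => ∫ ω, h k ω ∂μ) :
    ∀ᵐ ω ∂μ, Summable fun k => h k ω := by
  have hm : ∀ k, AEMeasurable (fun ω => ENNReal.ofReal (h k ω)) μ :=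
    fun k => (hi k).1.aemeasurable.ennreal_ofReal
  have h1 : ∫⁻ ω, ∑' k, ENNReal.ofReal (h k ω) ∂μ ≠ ⊤ := by
    rw [lintegral_tsum hm]
    have : ∀ k, ∫⁻ ω, ENNReal.ofReal (h k ω) ∂μ = ENNReal.ofReal (∫ ω, h k ω ∂μ) := fun k =>
      (ofReal_integral_eq_lintegral_ofReal (hi k) (Eventually.of_forall (h0 k))).symm
    simp_rw [this]
    exact hs.tsum_ofReal_ne_top
  filter_upwards [ae_lt_top' (AEMeasurable.tsum hm) h1] with ω hω
  have := ENNReal.summable_toReal hω.ne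
  simpa only [ENNReal.toReal_ofReal (h0 _ ω)] using this

/-- The Robbins–Siegmund almost supermartingale convergence theorem, for a summable
expected perturbation. -/
theorem robbins_siegmund [IsFiniteMeasure μ] {𝒢 : Filtration ℕ mΩ} {V ρ η : ℕ → Ω → ℝ}
    (hV0 : ∀ k ω, 0 ≤ V k ω) (hρ0 : ∀ k ω, 0 ≤ ρ k ω) (hη0 : ∀ k ω, 0 ≤ η k ω)
    (hVa : ∀ k, StronglyMeasurable[𝒢 k] (V k)) (hηa : ∀ k, StronglyMeasurable[𝒢 k] (η k))
    (hVi : ∀ k, Integrable (V k) μ) (hρi : ∀ k, Integrable (ρ k) μ)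
    (hηi : ∀ k, Integrable (η k) μ) (hηs : Summable fun k => ∫ ω, η k ω ∂μ)
    (h : ∀ k (A : Set Ω), MeasurableSet[𝒢 k] A →
      ∫ ω in A, V (k + 1) ω ∂μ + ∫ ω in A, ρ k ω ∂μ ≤ ∫ ω in A, V k ω ∂μ + ∫ ω in A, η k ω ∂μ) :
    ∀ᵐ ω ∂μ, (∃ l, Tendsto (fun k => V k ω) atTop (𝓝 l)) ∧ Summable fun k => ρ k ω := by
  have hη1 : ∀ k, 0 ≤ ∫ ω, η k ω ∂μ := fun k => integral_nonneg (hη0 k)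
  have hρ1 : ∀ k, 0 ≤ ∫ ω, ρ k ω ∂μ := fun k => integral_nonneg (hρ0 k)
  have hV1 : ∀ k, 0 ≤ ∫ ω, V k ω ∂μ := fun k => integral_nonneg (hV0 k)
  set T := ∑' k, ∫ ω, η k ω ∂μ with hT
  have hT' : ∀ k, ∑ l ∈ Finset.range k, ∫ ω, η l ω ∂μ ≤ T := fun k =>
    hηs.sum_le_tsum _ fun l _ => hη1 l
  have hsum : ∀ k, ∫ ω, V k ω ∂μ + ∑ l ∈ Finset.range k, ∫ ω, ρ l ω ∂μ
      ≤ ∫ ω, V 0 ω ∂μ + ∑ l ∈ Finset.range k, ∫ ω, η l ω ∂μ := by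
    intro k
    induction k with
    | zero => simp
    | succ k ih =>
      have h1 := h k Set.univ MeasurableSet.univ
      simp only [Measure.restrict_univ] at h1
      rw [Finset.sum_range_succ, Finset.sum_range_succ]
      linarith
  have hρs : Summable fun k => ∫ ω, ρ k ω ∂μ :=
    summable_of_sum_range_le (c := ∫ ω, V 0 ω ∂μ + T) hρ1 fun k => by
      linarith [hsum k, hV1 k, hT' k]
  -- Subtracting the past perturbations leaves a supermartingale bounded in `L¹`, so Doob's theorem
  -- applies to its negative.
  let M : ℕ → Ω → ℝ := fun k ω => V k ω - ∑ l ∈ Finset.range k, η l ω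
  have hSi : ∀ k, Integrable (fun ω => ∑ l ∈ Finset.range k, η l ω) μ := fun k =>
    integrable_finsetSum _ fun l _ => hηi l
  have hMi : ∀ k, Integrable (M k) μ := fun k => (hVi k).sub (hSi k)
  have hM : Supermartingale M 𝒢 μ := by
    refine supermartingale_of_setIntegral_succ_le (fun k => ?_) hMi fun k A hA => ?_
    · refine (hVa k).sub (Finset.stronglyMeasurable_fun_sum _ fun l hl => ?_)
      exact (hηa l).mono (𝒢.mono (Finset.mem_range.1 hl).le)
    · have h1 := h k A hA
      have h2 : 0 ≤ ∫ ω in A, ρ k ω ∂μ := integral_nonneg (hρ0 k)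
      have e1 : ∀ j, ∫ ω in A, M j ω ∂μ
          = ∫ ω in A, V j ω ∂μ - ∑ l ∈ Finset.range j, ∫ ω in A, η l ω ∂μ := by
        intro j
        rw [← integral_finsetSum _ fun l _ => (hηi l).integrableOn]
        exact integral_sub (hVi j).integrableOn (hSi j).integrableOn
      rw [e1, e1, Finset.sum_range_succ]
      linarith
  -- One `T` comes from the growth of `∫ V k`, the other from the subtracted sum.
  have hbound : ∀ k, eLpNorm ((-M) k) 1 μ ≤ (Real.toNNReal (∫ ω, V 0 ω ∂μ + 2 * T) : ENNReal) := by
    intro k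
    rw [Pi.neg_apply, eLpNorm_neg, eLpNorm_one_eq_lintegral_enorm,
      ← ofReal_integral_norm_eq_lintegral_enorm (hMi k)]
    refine ENNReal.ofReal_le_ofReal ?_
    calc ∫ ω, ‖M k ω‖ ∂μ ≤ ∫ ω, (V k ω + ∑ l ∈ Finset.range k, η l ω) ∂μ := by
          refine integral_mono (hMi k).norm ((hVi k).add (hSi k)) fun ω => ?_
          have : 0 ≤ ∑ l ∈ Finset.range k, η l ω := Finset.sum_nonneg fun l _ => hη0 l ω
          have := hV0 k ω
          simp only [M, Real.norm_eq_abs]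
          rw [abs_le]; constructor <;> linarith
      _ = ∫ ω, V k ω ∂μ + ∑ l ∈ Finset.range k, ∫ ω, η l ω ∂μ := by
          rw [← integral_finsetSum _ fun l _ => hηi l]
          exact integral_add (hVi k) (hSi k)
      _ ≤ _ := by
          have := Finset.sum_nonneg fun l (_ : l ∈ Finset.range k) => hρ1 l
          linarith [hsum k, hT' k]
  filter_upwards [hM.neg.exists_ae_tendsto_of_bdd hbound,
    ae_summable_of_summable_integral hη0 hηi hηs,
    ae_summable_of_summable_integral hρ0 hρi hρs] with ω ⟨c, hc⟩ hω1 hω2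
  refine ⟨⟨_, (hω1.hasSum.tendsto_sum_nat.sub hc).congr fun k => ?_⟩, hω2⟩
  simp [M]

end Integration

/-! ### Edge energy along a block. -/

section Deterministic

variable {ι E : Type*} [Fintype ι] [NormedAddCommGroup E]

/-- The weighted sum of the squared distances across the edges of a weight matrix. -/
noncomputable def edgeEnergy (A : Matrix ι ι ℝ) (x : ι → E) : ℝ :=
  ∑ i, ∑ j, A i j * ‖x j - x i‖ ^ 2

lemma edgeEnergy_nonneg {A : Matrix ι ι ℝ} (hA : ∀ i j, 0 ≤ A i j) (x : ι → E) :
    0 ≤ edgeEnergy A x :=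
  Finset.sum_nonneg fun i _ => Finset.sum_nonneg fun j _ => mul_nonneg (hA i j) (sq_nonneg _)

lemma row_le_edgeEnergy {A : Matrix ι ι ℝ} (hA : ∀ i j, 0 ≤ A i j) (x : ι → E) (i : ι) :
    ∑ j, A i j * ‖x j - x i‖ ^ 2 ≤ edgeEnergy A x :=
  Finset.single_le_sum (f := fun i => ∑ j, A i j * ‖x j - x i‖ ^ 2)
    (fun i _ => Finset.sum_nonneg fun j _ => mul_nonneg (hA i j) (sq_nonneg _))
    (Finset.mem_univ i)

lemma entry_le_edgeEnergy {A : Matrix ι ι ℝ} (hA : ∀ i j, 0 ≤ A i j) (x : ι → E) (i j : ι) :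
    A i j * ‖x j - x i‖ ^ 2 ≤ edgeEnergy A x :=
  (Finset.single_le_sum (f := fun j => A i j * ‖x j - x i‖ ^ 2)
    (fun j _ => mul_nonneg (hA i j) (sq_nonneg _)) (Finset.mem_univ j)).trans
    (row_le_edgeEnergy hA x i)

lemma norm_sub_sq_le_card_mul_sum (u : ℕ → E) (s k : ℕ) :
    ‖u (s + k) - u s‖ ^ 2 ≤ k * ∑ l ∈ Finset.range k, ‖u (s + l + 1) - u (s + l)‖ ^ 2 := by
  have h1 : u (s + k) - u s = ∑ l ∈ Finset.range k, (u (s + l + 1) - u (s + l)) :=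
    (Finset.sum_range_sub (fun l => u (s + l)) k).symm
  rw [h1]
  calc ‖∑ l ∈ Finset.range k, (u (s + l + 1) - u (s + l))‖ ^ 2
      ≤ (∑ l ∈ Finset.range k, ‖u (s + l + 1) - u (s + l)‖) ^ 2 := by
        gcongr; exact norm_sum_le _ _
    _ ≤ _ := by
        have := sq_sum_le_card_mul_sum_sq (s := Finset.range k)
          (f := fun l => ‖u (s + l + 1) - u (s + l)‖)
        rwa [Finset.card_range] at this

variable [InnerProductSpace ℝ E]

/-- Distances at the start of a block are controlled, across the edges that appear during the
block, by the edge energies of the block. -/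
lemma weight_mul_norm_sub_sq_le {A : ℕ → Matrix ι ι ℝ} {x g : ℕ → ι → E} {a : ℕ → ℝ} {Λ : ℝ}
    {s B : ℕ} (hA0 : ∀ k < B, ∀ i j, 0 ≤ A (s + k + 1) i j)
    (hA1 : ∀ k < B, ∀ i, ∑ j, A (s + k + 1) i j = 1)
    (hg : ∀ k < B, ∀ i, ‖g (s + k) i‖ ≤ Λ)
    (hx : ∀ k < B, ∀ i, x (s + k + 1) i
      = ∑ j, A (s + k + 1) i j • x (s + k) j - a (s + k) • g (s + k) i)
    {k : ℕ} (hk : k < B) (i j : ι) :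
    A (s + k + 1) i j * ‖x s j - x s i‖ ^ 2 ≤ 15 * B *
      ∑ l ∈ Finset.range B, (edgeEnergy (A (s + l + 1)) (x (s + l)) + Λ ^ 2 * a (s + l) ^ 2) := by
  set D := fun l => edgeEnergy (A (s + l + 1)) (x (s + l)) + Λ ^ 2 * a (s + l) ^ 2 with hD
  have hD0 : ∀ l < B, 0 ≤ D l := fun l hl =>
    add_nonneg (edgeEnergy_nonneg (hA0 l hl) _) (by positivity)
  -- An agent moves by mixing, which Jensen bounds by its row of the edge energy, and by a
  -- subgradient step of norm at most `Λ |a|`.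
  have hmove : ∀ l < B, ∀ i, ‖x (s + l + 1) i - x (s + l) i‖ ^ 2 ≤ 2 * D l := by
    intro l hl i
    have e : x (s + l + 1) i - x (s + l) i
      = (∑ j, A (s + l + 1) i j • x (s + l) j - x (s + l) i) - a (s + l) • g (s + l) i := by
      rw [hx l hl i]; abel
    rw [e]
    refine (norm_sub_sq_le_eps one_pos _ _).trans ?_
    have h1 := (norm_weighted_sub_sq_le (hA0 l hl i) (hA1 l hl i) (x (s + l))
      (x (s + l) i)).trans (row_le_edgeEnergy (hA0 l hl) (x (s + l)) i)
    have h2 : ‖a (s + l) • g (s + l) i‖ ^ 2 ≤ Λ ^ 2 * a (s + l) ^ 2 := by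
      rw [norm_smul, mul_pow, Real.norm_eq_abs, sq_abs, mul_comm]
      gcongr
      exact hg l hl i
    simp only [hD]
    norm_num
    linarith
  have hdisp : ∀ i, ‖x (s + k) i - x s i‖ ^ 2 ≤ 2 * B * ∑ l ∈ Finset.range B, D l := by
    intro i
    have hs0 : 0 ≤ ∑ l ∈ Finset.range k, 2 * D l := Finset.sum_nonneg fun l hl => by
      have := hD0 l ((Finset.mem_range.1 hl).trans hk)
      positivity
    calc ‖x (s + k) i - x s i‖ ^ 2
        ≤ k * ∑ l ∈ Finset.range k, ‖x (s + l + 1) i - x (s + l) i‖ ^ 2 :=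
          norm_sub_sq_le_card_mul_sum (fun t => x t i) s k
      _ ≤ k * ∑ l ∈ Finset.range k, 2 * D l := by
          gcongr with l hl
          exact hmove l ((Finset.mem_range.1 hl).trans hk) i
      _ ≤ B * ∑ l ∈ Finset.range B, 2 * D l := by
          refine mul_le_mul (by exact_mod_cast hk.le) ?_ hs0 (by positivity)
          refine Finset.sum_le_sum_of_subset_of_nonneg (Finset.range_mono hk.le) fun l hl _ => ?_
          have := hD0 l (Finset.mem_range.1 hl)
          positivity
      _ = _ := by rw [← Finset.mul_sum]; ring
  have hB : (1 : ℝ) ≤ B := by exact_mod_cast (Nat.zero_le k).trans_lt hk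
  have hkD : D k ≤ ∑ l ∈ Finset.range B, D l :=
    Finset.single_le_sum (f := D) (fun l hl => hD0 l (Finset.mem_range.1 hl))
      (Finset.mem_range.2 hk)
  set T := ∑ l ∈ Finset.range B, D l
  have hw0 := hA0 k hk i j
  have hw1 : A (s + k + 1) i j ≤ 1 := by
    rw [← hA1 k hk i]
    exact Finset.single_le_sum (f := fun j => A (s + k + 1) i j) (fun j _ => hA0 k hk i j)
      (Finset.mem_univ j)
  have hwk : A (s + k + 1) i j * ‖x (s + k) j - x (s + k) i‖ ^ 2 ≤ D k :=
    (entry_le_edgeEnergy (hA0 k hk) (x (s + k)) i j).trans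
      (le_add_of_nonneg_right (by positivity))
  have htri : ‖x s j - x s i‖ ^ 2 ≤ 3 * (‖x (s + k) j - x (s + k) i‖ ^ 2
      + ‖x (s + k) i - x s i‖ ^ 2 + ‖x (s + k) j - x s j‖ ^ 2) := by
    have h1 : ‖x s j - x s i‖ ≤ ‖x (s + k) j - x (s + k) i‖ + ‖x (s + k) i - x s i‖
        + ‖x (s + k) j - x s j‖ := by
      have e : x s j - x s i = (x (s + k) j - x (s + k) i) + (x (s + k) i - x s i)
        - (x (s + k) j - x s j) := by abel
      rw [e]
      refine (norm_sub_le _ _).trans ?_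
      gcongr
      exact norm_add_le _ _
    have h2 : ‖x s j - x s i‖ ^ 2 ≤ (‖x (s + k) j - x (s + k) i‖ + ‖x (s + k) i - x s i‖
        + ‖x (s + k) j - x s j‖) ^ 2 := by gcongr
    refine h2.trans ?_
    nlinarith [sq_nonneg (‖x (s + k) j - x (s + k) i‖ - ‖x (s + k) i - x s i‖),
      sq_nonneg (‖x (s + k) j - x (s + k) i‖ - ‖x (s + k) j - x s j‖),
      sq_nonneg (‖x (s + k) i - x s i‖ - ‖x (s + k) j - x s j‖)]
  have hi := hdisp i
  have hj := hdisp j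
  -- With both displacements at most `2 * B * T`, the total is `3 * T + 12 * B * T ≤ 15 * B * T`.
  have h3 : A (s + k + 1) i j * ‖x s j - x s i‖ ^ 2 ≤ 3 * D k
      + 3 * (‖x (s + k) i - x s i‖ ^ 2 + ‖x (s + k) j - x s j‖ ^ 2) := by
    have h4 := mul_le_mul_of_nonneg_left htri hw0
    have h5 : A (s + k + 1) i j * (‖x (s + k) i - x s i‖ ^ 2 + ‖x (s + k) j - x s j‖ ^ 2)
      ≤ 1 * (‖x (s + k) i - x s i‖ ^ 2 + ‖x (s + k) j - x s j‖ ^ 2) := by gcongr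
    linarith
  have hS0 : 0 ≤ T := (hD0 k hk).trans hkD
  nlinarith

end Deterministic

/-! ### The deterministic subgradient step. -/

section Objective

variable {n m : ℕ} {f : Fin n → EuclideanSpace ℝ (Fin m) → ℝ} {L : Fin n → ℝ}

/-- Equivalence of norms turns the `ℓ∞` bounds into one Euclidean bound; absolute values make it
nonnegative whatever the sign of `L i`. -/
lemma ObjectiveAssumption.exists_norm_subgradient_le (hf : ObjectiveAssumption f L) :
    ∃ Λ : ℝ, 0 ≤ Λ ∧ ∀ i z, ∀ g ∈ subgradients (f i) z, ‖g‖ ≤ Λ := by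
  set T : (Fin m → ℝ) →L[ℝ] EuclideanSpace ℝ (Fin m) :=
    (EuclideanSpace.equiv (Fin m) ℝ).symm.toContinuousLinearMap with hT
  refine ⟨‖T‖ * ∑ i, |L i|, by positivity, fun i z g hg => ?_⟩
  have h1 : ‖g‖ ≤ ‖T‖ * supNorm g := T.le_opNorm (WithLp.ofLp g)
  have h2 : L i ≤ ∑ i, |L i| := (le_abs_self _).trans
    (Finset.single_le_sum (f := fun i => |L i|) (fun _ _ => abs_nonneg _) (Finset.mem_univ i))
  exact h1.trans (by gcongr; exact (hf.subgradient_bound i z g hg).trans h2)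

lemma ObjectiveAssumption.continuous (hf : ObjectiveAssumption f L) (i : Fin n) :
    Continuous (f i) :=
  continuousOn_univ.1 ((hf.convex i).continuousOn isOpen_univ)

lemma ObjectiveAssumption.continuous_totalCost (hf : ObjectiveAssumption f L) :
    Continuous (totalCost f) :=
  continuous_finsetSum _ fun i _ => hf.continuous i

lemma ObjectiveAssumption.sub_le (hf : ObjectiveAssumption f L) {Λ : ℝ}
    (hΛ : ∀ i z, ∀ g ∈ subgradients (f i) z, ‖g‖ ≤ Λ) (i : Fin n)
    (y z : EuclideanSpace ℝ (Fin m)) : f i y - f i z ≤ Λ * ‖z - y‖ := by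
  obtain ⟨g, hg⟩ := exists_subgradient (hf.convex i) y
  have h1 := hg z
  have h2 := neg_le_of_abs_le (abs_real_inner_le_norm g (z - y))
  have h3 : ‖g‖ * ‖z - y‖ ≤ Λ * ‖z - y‖ := by gcongr; exact hΛ i y g hg
  linarith

/-- The cross term is split at `x i`, where the subgradient inequality holds. With `r = √(disp x)`,
passing to the mixed point costs `2 Λ r` and passing to the average `Λ r`; then `6 Λ a r ≤ 3 Λ (a ^
2 + r ^ 2)`. -/
lemma ObjectiveAssumption.sum_norm_step_sub_sq_le (hf : ObjectiveAssumption f L) {Λ : ℝ}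
    (hΛ0 : 0 ≤ Λ) (hΛ : ∀ i z, ∀ g ∈ subgradients (f i) z, ‖g‖ ≤ Λ)
    {A : Matrix (Fin n) (Fin n) ℝ} (hA0 : ∀ i j, 0 ≤ A i j) (hA1 : ∀ i, ∑ j, A i j = 1)
    {x g : Fin n → EuclideanSpace ℝ (Fin m)} (hg : ∀ i, g i ∈ subgradients (f i) (x i))
    {a : ℝ} (ha : 0 ≤ a) (z : EuclideanSpace ℝ (Fin m)) :
    ∑ i, ‖(∑ j, A i j • x j - a • g i) - z‖ ^ 2
        + 2 * (a * (totalCost f (avg x) - totalCost f z))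
      ≤ ∑ i, ‖(∑ j, A i j • x j) - z‖ ^ 2 + n * (3 * Λ + Λ ^ 2) * (a ^ 2 + disp x) := by
  set r := √(disp x) with hr
  have hr0 : 0 ≤ r := Real.sqrt_nonneg _
  have hr2 : r ^ 2 = disp x := Real.sq_sqrt (disp_nonneg x)
  have key : ∀ i, ‖(∑ j, A i j • x j - a • g i) - z‖ ^ 2 + 2 * (a * (f i (avg x) - f i z))
      ≤ ‖(∑ j, A i j • x j) - z‖ ^ 2 + (3 * Λ + Λ ^ 2) * (a ^ 2 + disp x) := by
    intro i
    set y := ∑ j, A i j • x j with hy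
    have hgn := hΛ i _ _ (hg i)
    have e : (y - a • g i) - z = (y - z) - a • g i := by abel
    have e2 : ‖(y - z) - a • g i‖ ^ 2
        = ‖y - z‖ ^ 2 - 2 * (a * inner ℝ (g i) (y - z)) + a ^ 2 * ‖g i‖ ^ 2 := by
      rw [norm_sub_sq_real, inner_smul_right, norm_smul, mul_pow, Real.norm_eq_abs, sq_abs,
        real_inner_comm]
    have e3 : inner ℝ (g i) (y - z) = inner ℝ (g i) (y - x i) - inner ℝ (g i) (z - x i) := by
      rw [← inner_sub_right]; congr 1; abel
    have h1 := hg i z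
    have h2 : ‖y - x i‖ ≤ 2 * r := by
      refine abs_le_of_sq_le_sq' ?_ (by positivity) |>.2
      refine (norm_weighted_sub_sq_le (hA0 i) (hA1 i) x (x i)).trans ?_
      calc ∑ j, A i j * ‖x j - x i‖ ^ 2 ≤ ∑ j, A i j * (4 * disp x) := by
            gcongr with j
            · exact hA0 i j
            · exact norm_sub_sq_le_disp x j i
        _ = _ := by rw [← Finset.sum_mul, hA1, ← hr2]; ring
    have h3 : -(Λ * (2 * r)) ≤ inner ℝ (g i) (y - x i) := by
      have := neg_le_of_abs_le (abs_real_inner_le_norm (g i) (y - x i))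
      have : ‖g i‖ * ‖y - x i‖ ≤ Λ * (2 * r) := by gcongr
      linarith
    have h4 : f i (avg x) - f i (x i) ≤ Λ * r :=
      (hf.sub_le hΛ i _ _).trans (by
        gcongr; exact Real.le_sqrt_of_sq_le (norm_sub_avg_sq_le x i))
    have h5 : f i (avg x) - f i z - 3 * (Λ * r) ≤ inner ℝ (g i) (y - z) := by
      rw [e3]; linarith
    have h6 := mul_le_mul_of_nonneg_left h5 ha
    have h7 : a ^ 2 * ‖g i‖ ^ 2 ≤ a ^ 2 * Λ ^ 2 := by gcongr
    have h8 : Λ * (2 * (a * r)) ≤ Λ * (a ^ 2 + r ^ 2) := by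
      gcongr; nlinarith [sq_nonneg (a - r)]
    have h9 : 0 ≤ Λ ^ 2 * r ^ 2 := by positivity
    rw [e, e2, ← hr2]
    linarith
  have hsum := Finset.sum_le_sum fun i (_ : i ∈ Finset.univ) => key i
  rw [Finset.sum_add_distrib, Finset.sum_add_distrib, ← Finset.mul_sum, ← Finset.mul_sum,
    Finset.sum_sub_distrib, Finset.sum_const, Finset.card_univ, Fintype.card_fin,
    nsmul_eq_mul] at hsum
  simp only [totalCost]
  linarith

end Objective

/-! ### Averaging with the random weights. -/

section Weights

variable {n : ℕ} {Ω : Type*} [mΩ : MeasurableSpace Ω] {μ : Measure Ω}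
  {ℱ : Filtration ℕ mΩ} {t₀ : ℕ} {W : ℕ → Ω → Matrix (Fin n) (Fin n) ℝ}

lemma StochasticAssumption.ae_row (hW : StochasticAssumption μ ℱ t₀ W) {t : ℕ} (ht : t₀ ≤ t) :
    ∀ᵐ ω ∂μ, (∀ i j, 0 ≤ W t ω i j) ∧ ∀ i, ∑ j, W t ω i j = 1 := by
  filter_upwards [hW.rowStochastic t ht] with ω hω
  refine ⟨(Matrix.mem_rowStochastic.1 hω).1, fun i => ?_⟩
  simpa [Matrix.mulVec, dotProduct] using congrFun (Matrix.mem_rowStochastic.1 hω).2 i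

lemma StochasticAssumption.ae_col (hW : StochasticAssumption μ ℱ t₀ W) {t : ℕ} (ht : t₀ ≤ t) :
    ∀ᵐ ω ∂μ, ∀ j, ∑ i, (μ[fun ω' => W (t + 1) ω' i j | ℱ t]) ω = 1 := by
  filter_upwards [hW.colStochastic (t + 1) (by omega)] with ω hω j
  simpa [Matrix.vecMul, dotProduct, condExpMatrix] using
    congrFun (Matrix.mem_colStochastic.1 hω).2 j

lemma StochasticAssumption.memLp (hW : StochasticAssumption μ ℱ t₀ W) {t : ℕ} (ht : t₀ ≤ t)
    (i j : Fin n) : MemLp (fun ω => W t ω i j) ⊤ μ := by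
  refine memLp_top_of_bound
    ((hW.adapted t ht i j).mono (ℱ.le t) le_rfl).aestronglyMeasurable 1 ?_
  filter_upwards [hW.ae_row ht] with ω hω
  rw [Real.norm_eq_abs, abs_of_nonneg (hω.1 i j), ← hω.2 i]
  exact Finset.single_le_sum (f := fun j => W t ω i j) (fun j _ => hω.1 i j) (Finset.mem_univ j)

variable [IsProbabilityMeasure μ]

/-- As `h j` is known at time `t`, the weights may be replaced by their conditional expectations,
whose column sums are one. -/
lemma StochasticAssumption.setIntegral_sum_weight_mul (hW : StochasticAssumption μ ℱ t₀ W)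
    {t : ℕ} (ht : t₀ ≤ t) {h : Fin n → Ω → ℝ} (hm : ∀ j, StronglyMeasurable[ℱ t] (h j))
    (hh : ∀ j, MemLp (h j) ⊤ μ) {A : Set Ω} (hA : MeasurableSet[ℱ t] A) :
    ∫ ω in A, ∑ i, ∑ j, W (t + 1) ω i j * h j ω ∂μ = ∫ ω in A, ∑ j, h j ω ∂μ := by
  have hWm := fun i j => hW.memLp (t := t + 1) (by omega) i j
  have hi : ∀ i j, Integrable (fun ω => W (t + 1) ω i j * h j ω) μ :=
    fun i j => memLp_top_integrable (memLp_top_mul (hWm i j) (hh j))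
  have hi' : ∀ i j, Integrable
      (fun ω => (μ[fun ω' => W (t + 1) ω' i j | ℱ t]) ω * h j ω) μ :=
    fun i j => integrable_condExp_mul (hWm i j) (hm j) (hh j)
  calc ∫ ω in A, ∑ i, ∑ j, W (t + 1) ω i j * h j ω ∂μ
      = ∑ i, ∑ j, ∫ ω in A, W (t + 1) ω i j * h j ω ∂μ := by
        rw [integral_finsetSum _ fun i _ =>
          (integrable_finsetSum _ fun j _ => hi i j).integrableOn]
        exact Finset.sum_congr rfl fun i _ =>
          integral_finsetSum _ fun j _ => (hi i j).integrableOn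
    _ = ∑ i, ∑ j, ∫ ω in A, (μ[fun ω' => W (t + 1) ω' i j | ℱ t]) ω * h j ω ∂μ :=
        Finset.sum_congr rfl fun i _ => Finset.sum_congr rfl fun j _ =>
          (setIntegral_condExp_mul (ℱ.le t) (hWm i j) (hm j) (hh j) hA).symm
    _ = ∫ ω in A, ∑ i, ∑ j, (μ[fun ω' => W (t + 1) ω' i j | ℱ t]) ω * h j ω ∂μ := by
        rw [integral_finsetSum _ fun i _ =>
          (integrable_finsetSum _ fun j _ => hi' i j).integrableOn]
        exact Finset.sum_congr rfl fun i _ =>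
          (integral_finsetSum _ fun j _ => (hi' i j).integrableOn).symm
    _ = ∫ ω in A, ∑ j, h j ω ∂μ := by
        refine integral_congr_ae (ae_restrict_of_ae ?_)
        filter_upwards [hW.ae_col ht] with ω hω
        rw [Finset.sum_comm]
        refine Finset.sum_congr rfl fun j _ => ?_
        rw [← Finset.sum_mul, hω j, one_mul]

variable {m : ℕ} {γ : ℝ}

lemma StochasticAssumption.memLp_mix (hW : StochasticAssumption μ ℱ t₀ W)
    {t : ℕ} (ht : t₀ ≤ t) {x : Ω → Fin n → EuclideanSpace ℝ (Fin m)} (hx : MemLp x ⊤ μ)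
    (i : Fin n) : MemLp (fun ω => ∑ j, W t ω i j • x ω j) ⊤ μ :=
  memLp_finsetSum _ fun j _ =>
    (memLp_top_comp_continuous (continuous_apply j) hx).smul (hW.memLp ht i j)

lemma StochasticAssumption.memLp_edgeEnergy (hW : StochasticAssumption μ ℱ t₀ W)
    {t : ℕ} (ht : t₀ ≤ t) {x : Ω → Fin n → EuclideanSpace ℝ (Fin m)} (hx : MemLp x ⊤ μ) :
    MemLp (fun ω => edgeEnergy (W t ω) (x ω)) ⊤ μ :=
  memLp_finsetSum _ fun i _ => memLp_finsetSum _ fun j _ =>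
    memLp_top_mul (hW.memLp ht i j) (memLp_top_comp_continuous
      (φ := fun y : Fin n → EuclideanSpace ℝ (Fin m) => ‖y j - y i‖ ^ 2) (by fun_prop) hx)

/-- Mixing decreases the sum of squared distances to a known point, on average, by a multiple of
the edge energy. -/
lemma StochasticAssumption.setIntegral_mix_le (hW : StochasticAssumption μ ℱ t₀ W)
    (hC : ConnectivityAssumption μ ℱ t₀ W γ) (hγ1 : γ ≤ 1) {t : ℕ} (ht : t₀ ≤ t)
    {x : Ω → Fin n → EuclideanSpace ℝ (Fin m)} (hxm : Measurable[ℱ t] x) (hx : MemLp x ⊤ μ)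
    {c : Ω → EuclideanSpace ℝ (Fin m)} (hcm : Measurable[ℱ t] c) (hc : MemLp c ⊤ μ)
    {A : Set Ω} (hA : MeasurableSet[ℱ t] A) :
    ∫ ω in A, ∑ i, ‖(∑ j, W (t + 1) ω i j • x ω j) - c ω‖ ^ 2 ∂μ
        + γ / 4 * ∫ ω in A, edgeEnergy (W (t + 1) ω) (x ω) ∂μ
      ≤ ∫ ω in A, ∑ j, ‖x ω j - c ω‖ ^ 2 ∂μ := by
  have ht1 : t₀ ≤ t + 1 := by omega
  have hxc : ∀ j, MemLp (fun ω => ‖x ω j - c ω‖ ^ 2) ⊤ μ := fun j =>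
    memLp_top_norm_sq ((memLp_top_comp_continuous (continuous_apply j) hx).sub hc)
  have hmix : Integrable (fun ω => ∑ i, ‖(∑ j, W (t + 1) ω i j • x ω j) - c ω‖ ^ 2) μ :=
    memLp_top_integrable (memLp_finsetSum _ fun i _ =>
      memLp_top_norm_sq ((hW.memLp_mix ht1 hx i).sub hc))
  have hen := memLp_top_integrable (hW.memLp_edgeEnergy ht1 hx)
  rw [← hW.setIntegral_sum_weight_mul ht (h := fun j ω => ‖x ω j - c ω‖ ^ 2) (fun j => ?_) hxc hA,
    ← integral_const_mul, ← integral_add hmix.integrableOn (hen.const_mul _).integrableOn]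
  · refine integral_mono_ae (hmix.add (hen.const_mul _)).integrableOn
      (integrable_finsetSum _ fun i _ => integrable_finsetSum _ fun j _ =>
        memLp_top_integrable (memLp_top_mul (hW.memLp ht1 i j) (hxc j))).integrableOn
      (ae_restrict_of_ae ?_)
    filter_upwards [hW.ae_row ht1, hC.self_loop (t + 1) ht1] with ω hω hloop
    rw [edgeEnergy, Finset.mul_sum, ← Finset.sum_add_distrib]
    exact Finset.sum_le_sum fun i _ => norm_weighted_sub_sq_add_le (hω.1 i) (hω.2 i) hγ1
      (le_of_lt (hloop i)) (x ω) (c ω)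
  · have h1 : Measurable[ℱ t] fun ω => x ω j - c ω :=
      ((measurable_pi_apply j).comp hxm).sub hcm
    have h2 : Continuous fun v : EuclideanSpace ℝ (Fin m) => ‖v‖ ^ 2 := by fun_prop
    exact (h2.measurable.comp h1).stronglyMeasurable

end Weights

/-! ### Expected dispersion and Fejér monotonicity of the trajectory. -/

section Dynamics

variable {n m : ℕ} {Ω : Type*} [mΩ : MeasurableSpace Ω] {μ : Measure Ω}
  {ℱ : Filtration ℕ mΩ} {t₀ : ℕ} {f : Fin n → EuclideanSpace ℝ (Fin m) → ℝ} {L : Fin n → ℝ}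
  {W : ℕ → Ω → Matrix (Fin n) (Fin n) ℝ} {γ : ℝ} {α : ℕ → ℝ}
  {x₀ : Fin n → EuclideanSpace ℝ (Fin m)} {x g : ℕ → Ω → Fin n → EuclideanSpace ℝ (Fin m)}
  {Λ : ℝ}

lemma IsSubgradientDynamics.measurable (hx : IsSubgradientDynamics ℱ t₀ f W α x₀ x g)
    (hW : StochasticAssumption μ ℱ t₀ W) {t : ℕ} (ht : t₀ ≤ t) : Measurable[ℱ t] (x t) := by
  induction t, ht using Nat.le_induction with
  | base =>
    have : x t₀ = fun _ => x₀ := by ext1 ω; ext1 i; exact hx.initial ω i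
    rw [this]
    exact measurable_const
  | succ t ht ih =>
    refine (@measurable_pi_iff _ _ _ (ℱ (t + 1)) _ _).2 fun i => ?_
    have : (fun ω => x (t + 1) ω i)
        = fun ω => ∑ j, W (t + 1) ω i j • x t ω j - α t • g t ω i := by
      ext1 ω; exact hx.step t ht ω i
    rw [this]
    have hle : ℱ t ≤ ℱ (t + 1) := ℱ.mono (Nat.le_succ t)
    have hg : Measurable[ℱ (t + 1)] fun ω => g t ω i := (hx.adapted t ht i).mono hle le_rfl
    have hxj : ∀ j, Measurable[ℱ (t + 1)] fun ω => x t ω j := fun j =>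
      ((measurable_pi_apply j).comp ih).mono hle le_rfl
    have hWj : ∀ j, Measurable[ℱ (t + 1)] fun ω => W (t + 1) ω i j :=
      hW.adapted (t + 1) (by omega) i
    exact Measurable.sub (Finset.measurable_fun_sum _ fun j _ => (hWj j).smul (hxj j))
      (hg.const_smul (α t))

lemma IsSubgradientDynamics.norm_subgradient_le
    (hx : IsSubgradientDynamics ℱ t₀ f W α x₀ x g)
    (hΛ : ∀ i z, ∀ g ∈ subgradients (f i) z, ‖g‖ ≤ Λ) {t : ℕ} (ht : t₀ ≤ t) (ω : Ω) (i : Fin n) :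
    ‖g t ω i‖ ≤ Λ := hΛ i _ _ (hx.subgradient t ht ω i)

/-- Convex combinations do not enlarge norms, so each step adds at most `|α t| * |Λ|` to a
deterministic bound. -/
lemma IsSubgradientDynamics.memLp (hx : IsSubgradientDynamics ℱ t₀ f W α x₀ x g)
    (hW : StochasticAssumption μ ℱ t₀ W) (hΛ : ∀ i z, ∀ g ∈ subgradients (f i) z, ‖g‖ ≤ Λ)
    {t : ℕ} (ht : t₀ ≤ t) : MemLp (x t) ⊤ μ := by
  suffices h : ∃ C : ℝ, 0 ≤ C ∧ ∀ᵐ ω ∂μ, ∀ i, ‖x t ω i‖ ≤ C by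
    obtain ⟨C, hC, h⟩ := h
    refine memLp_top_of_bound
      ((hx.measurable hW ht).mono (ℱ.le t) le_rfl).aestronglyMeasurable C ?_
    filter_upwards [h] with ω hω
    exact (pi_norm_le_iff_of_nonneg hC).2 hω
  induction t, ht using Nat.le_induction with
  | base =>
    refine ⟨‖x₀‖, norm_nonneg _, Eventually.of_forall fun ω i => ?_⟩
    rw [hx.initial]
    exact norm_le_pi_norm x₀ i
  | succ t ht ih =>
    obtain ⟨C, hC, h⟩ := ih
    refine ⟨C + |α t| * |Λ|, by positivity, ?_⟩
    filter_upwards [h, hW.ae_row (t := t + 1) (by omega)] with ω hω hrow i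
    rw [hx.step t ht]
    refine (norm_sub_le _ _).trans (add_le_add ?_ ?_)
    · refine (norm_sum_le _ _).trans ?_
      calc ∑ j, ‖W (t + 1) ω i j • x t ω j‖ ≤ ∑ j, W (t + 1) ω i j * C := by
            refine Finset.sum_le_sum fun j _ => ?_
            rw [norm_smul, Real.norm_eq_abs, abs_of_nonneg (hrow.1 i j)]
            exact mul_le_mul_of_nonneg_left (hω j) (hrow.1 i j)
        _ = C := by rw [← Finset.sum_mul, hrow.2, one_mul]
    · rw [norm_smul, Real.norm_eq_abs]
      exact mul_le_mul_of_nonneg_left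
        ((hx.norm_subgradient_le hΛ ht ω i).trans (le_abs_self _)) (abs_nonneg _)

variable [IsProbabilityMeasure μ]

/-- The average need not be preserved, so the new dispersion is measured from the old average, which
is known at time `t`. A free `ε` keeps the growth factor as close to one as needed. -/
lemma integral_disp_succ_le [NeZero n] (hx : IsSubgradientDynamics ℱ t₀ f W α x₀ x g)
    (hW : StochasticAssumption μ ℱ t₀ W) (hC : ConnectivityAssumption μ ℱ t₀ W γ)
    (hγ0 : 0 < γ) (hγ1 : γ ≤ 1) (hΛ : ∀ i z, ∀ g ∈ subgradients (f i) z, ‖g‖ ≤ Λ)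
    {t : ℕ} (ht : t₀ ≤ t) {ε : ℝ} (hε : 0 < ε) :
    ∫ ω, disp (x (t + 1) ω) ∂μ ≤ (1 + ε) * ∫ ω, disp (x t ω) ∂μ
      - γ / 4 * ∫ ω, edgeEnergy (W (t + 1) ω) (x t ω) ∂μ + (1 + ε⁻¹) * n * Λ ^ 2 * α t ^ 2 := by
  have ht1 : t₀ ≤ t + 1 := by omega
  have hxt := hx.memLp hW hΛ ht
  have hc := memLp_top_comp_continuous (continuous_avg (ι := Fin n)) hxt
  have h1 := hW.setIntegral_mix_le hC hγ1 ht (hx.measurable hW ht) hxt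
    (continuous_avg.measurable.comp (hx.measurable hW ht)) hc MeasurableSet.univ
  simp only [Measure.restrict_univ, Function.comp_apply] at h1
  have hmix : Integrable
      (fun ω => ∑ i, ‖(∑ j, W (t + 1) ω i j • x t ω j) - avg (x t ω)‖ ^ 2) μ :=
    memLp_top_integrable (memLp_finsetSum _ fun i _ =>
      memLp_top_norm_sq ((hW.memLp_mix ht1 hxt i).sub hc))
  have hd := memLp_top_integrable
    (memLp_top_comp_continuous continuous_disp (hx.memLp hW hΛ ht1))
  have hE0 : 0 ≤ ∫ ω, edgeEnergy (W (t + 1) ω) (x t ω) ∂μ :=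
    integral_nonneg_of_ae (by
      filter_upwards [hW.ae_row ht1] with ω hω using edgeEnergy_nonneg hω.1 _)
  have h2 : ∫ ω, disp (x (t + 1) ω) ∂μ ≤ ∫ ω, ((1 + ε) *
      ∑ i, ‖(∑ j, W (t + 1) ω i j • x t ω j) - avg (x t ω)‖ ^ 2
      + (1 + ε⁻¹) * n * Λ ^ 2 * α t ^ 2) ∂μ := by
    refine integral_mono hd ((hmix.const_mul _).add (integrable_const _)) fun ω => ?_
    refine (disp_le _ (avg (x t ω))).trans ?_
    calc ∑ i, ‖x (t + 1) ω i - avg (x t ω)‖ ^ 2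
        ≤ ∑ i, ((1 + ε) * ‖(∑ j, W (t + 1) ω i j • x t ω j) - avg (x t ω)‖ ^ 2
          + (1 + ε⁻¹) * (Λ ^ 2 * α t ^ 2)) := by
          refine Finset.sum_le_sum fun i _ => ?_
          rw [hx.step t ht, sub_right_comm]
          refine (norm_sub_sq_le_eps hε _ _).trans ?_
          gcongr
          rw [norm_smul, mul_pow, Real.norm_eq_abs, sq_abs, mul_comm]
          gcongr
          exact hx.norm_subgradient_le hΛ ht ω i
      _ = _ := by
          rw [Finset.sum_add_distrib, ← Finset.mul_sum, Finset.sum_const, Finset.card_univ,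
            Fintype.card_fin, nsmul_eq_mul]
          ring
  rw [integral_add (hmix.const_mul _) (integrable_const _), integral_const_mul] at h2
  simp only [integral_const, probReal_univ, one_smul] at h2
  have h3 : (1 + ε) * ∫ ω, ∑ i, ‖(∑ j, W (t + 1) ω i j • x t ω j) - avg (x t ω)‖ ^ 2 ∂μ
      ≤ (1 + ε) * (∫ ω, disp (x t ω) ∂μ
        - γ / 4 * ∫ ω, edgeEnergy (W (t + 1) ω) (x t ω) ∂μ) := by
    refine mul_le_mul_of_nonneg_left ?_ (by positivity)
    have e : ∫ ω, disp (x t ω) ∂μ = ∫ ω, ∑ j, ‖x t ω j - avg (x t ω)‖ ^ 2 ∂μ := rfl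
    rw [e]; linarith
  have h4 : 0 ≤ ε * (γ / 4 * ∫ ω, edgeEnergy (W (t + 1) ω) (x t ω) ∂μ) := by positivity
  linarith

/-- Distances at the block start are `ℱ (k * B)`-measurable, so in mean the conditional weights
defining the graph can be exchanged for the actual ones, to which `weight_mul_norm_sub_sq_le`
applies pathwise. -/
lemma integral_disp_block_le [NeZero n] (hx : IsSubgradientDynamics ℱ t₀ f W α x₀ x g)
    (hW : StochasticAssumption μ ℱ t₀ W) (hγ0 : 0 < γ)
    (hΛ : ∀ i z, ∀ g ∈ subgradients (f i) z, ‖g‖ ≤ Λ) {B k : ℕ} (hs : t₀ ≤ k * B)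
    (hgraph : ∀ᵐ ω ∂μ, HasSpanningRootedTree (blockGraph μ ℱ W γ B k ω)) :
    ∫ ω, disp (x (k * B) ω) ∂μ ≤ (n : ℝ) ^ 3 * γ⁻¹ * (B * n * n * (15 * B)) *
      ∑ l ∈ Finset.range B, (∫ ω, edgeEnergy (W (k * B + l + 1) ω) (x (k * B + l) ω) ∂μ
        + Λ ^ 2 * α (k * B + l) ^ 2) := by
  set s := k * B with hsdef
  have hxs := hx.memLp hW hΛ hs
  have hsl : ∀ l, t₀ ≤ s + l + 1 := fun l => by omega
  let h : Fin n → Fin n → Ω → ℝ := fun i j ω => ‖x s ω j - x s ω i‖ ^ 2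
  have hφ : ∀ i j, Continuous fun y : Fin n → EuclideanSpace ℝ (Fin m) => ‖y j - y i‖ ^ 2 :=
    fun i j => by fun_prop
  have hh : ∀ i j, MemLp (h i j) ⊤ μ := fun i j => memLp_top_comp_continuous (hφ i j) hxs
  have hhm : ∀ i j, StronglyMeasurable[ℱ s] (h i j) := fun i j =>
    ((hφ i j).measurable.comp (hx.measurable hW hs)).stronglyMeasurable
  let p : ℕ → Fin n → Fin n → Ω → ℝ := fun l i j => μ[fun ω' => W (s + l + 1) ω' i j | ℱ s]
  have hp0 : ∀ᵐ ω ∂μ, ∀ l i j, 0 ≤ p l i j ω := by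
    simp only [ae_all_iff]
    intro l i j
    refine condExp_nonneg ?_
    filter_upwards [hW.ae_row (hsl l)] with ω hω using hω.1 i j
  have hpi : ∀ l i j, Integrable (fun ω => p l i j ω * h i j ω) μ := fun l i j =>
    integrable_condExp_mul (hW.memLp (hsl l) i j) (hhm i j) (hh i j)
  have hpint : ∀ l i j, ∫ ω, p l i j ω * h i j ω ∂μ
      = ∫ ω, W (s + l + 1) ω i j * h i j ω ∂μ := by
    intro l i j
    have := setIntegral_condExp_mul (ℱ.le s) (hW.memLp (hsl l) i j) (hhm i j) (hh i j)
      MeasurableSet.univ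
    simpa only [Measure.restrict_univ] using this
  have hEi : ∀ l, Integrable (fun ω => edgeEnergy (W (s + l + 1) ω) (x (s + l) ω)) μ := fun l =>
    memLp_top_integrable (hW.memLp_edgeEnergy (hsl l) (hx.memLp hW hΛ (by omega)))
  have hEci : ∀ l, Integrable (fun ω =>
      edgeEnergy (W (s + l + 1) ω) (x (s + l) ω) + Λ ^ 2 * α (s + l) ^ 2) μ := fun l =>
    (hEi l).add (integrable_const _)
  have hDi : Integrable (fun ω => ∑ l ∈ Finset.range B,
      (edgeEnergy (W (s + l + 1) ω) (x (s + l) ω) + Λ ^ 2 * α (s + l) ^ 2)) μ :=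
    integrable_finsetSum _ fun l _ => hEci l
  have hDint : ∫ ω, ∑ l ∈ Finset.range B,
      (edgeEnergy (W (s + l + 1) ω) (x (s + l) ω) + Λ ^ 2 * α (s + l) ^ 2) ∂μ
      = ∑ l ∈ Finset.range B, (∫ ω, edgeEnergy (W (s + l + 1) ω) (x (s + l) ω) ∂μ
        + Λ ^ 2 * α (s + l) ^ 2) := by
    rw [integral_finsetSum _ fun l _ => hEci l]
    refine Finset.sum_congr rfl fun l _ => ?_
    rw [integral_add (hEi l) (integrable_const _)]
    simp
  have hrow : ∀ᵐ ω ∂μ, ∀ l, (∀ i j, 0 ≤ W (s + l + 1) ω i j)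
      ∧ ∀ i, ∑ j, W (s + l + 1) ω i j = 1 := ae_all_iff.2 fun l => hW.ae_row (hsl l)
  have hedge : ∀ l < B, ∀ i j, ∫ ω, p l i j ω * h i j ω ∂μ ≤ 15 * B *
      ∑ l ∈ Finset.range B, (∫ ω, edgeEnergy (W (s + l + 1) ω) (x (s + l) ω) ∂μ
        + Λ ^ 2 * α (s + l) ^ 2) := by
    intro l hl i j
    rw [hpint, ← hDint, ← integral_const_mul]
    refine integral_mono_ae (memLp_top_integrable
      (memLp_top_mul (hW.memLp (hsl l) i j) (hh i j))) (hDi.const_mul _) ?_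
    filter_upwards [hrow] with ω hω
    exact weight_mul_norm_sub_sq_le (A := fun t => W t ω) (x := fun t => x t ω)
      (g := fun t => g t ω) (a := α) (s := s) (fun l _ => (hω l).1) (fun l _ => (hω l).2)
      (fun l _ i => hx.norm_subgradient_le hΛ (by omega) ω i)
      (fun l _ i => hx.step (s + l) (by omega) ω i) hl i j
  have hsumi : Integrable (fun ω => ∑ l ∈ Finset.range B, ∑ i, ∑ j, p l i j ω * h i j ω) μ :=
    integrable_finsetSum _ fun l _ => integrable_finsetSum _ fun i _ =>
      integrable_finsetSum _ fun j _ => hpi l i j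
  have hdisp : ∀ᵐ ω ∂μ, disp (x s ω) ≤ (n : ℝ) ^ 3 * γ⁻¹ *
      ∑ l ∈ Finset.range B, ∑ i, ∑ j, p l i j ω * h i j ω := by
    filter_upwards [hgraph, hp0] with ω hG hp
    have hterm : ∀ l i j, 0 ≤ p l i j ω * h i j ω := fun l i j =>
      mul_nonneg (hp l i j) (sq_nonneg _)
    have hsum0 : 0 ≤ ∑ l ∈ Finset.range B, ∑ i, ∑ j, p l i j ω * h i j ω :=
      Finset.sum_nonneg fun l _ => Finset.sum_nonneg fun i _ => Finset.sum_nonneg fun j _ =>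
        hterm l i j
    have key := disp_le_of_spanningRootedTree (x := x s ω)
      (e := γ⁻¹ * ∑ l ∈ Finset.range B, ∑ i, ∑ j, p l i j ω * h i j ω) hG (by positivity) ?_
    · rw [Fintype.card_fin] at key
      rw [mul_assoc]; exact key
    -- An edge has conditional weight above `γ`, so its squared length is at most `γ⁻¹` times the
    -- full weighted sum.
    · rintro j i ⟨τ, hτ, hadj⟩
      rw [Finset.mem_Icc, add_mul, one_mul, ← hsdef] at hτ
      obtain ⟨l, rfl⟩ : ∃ l, τ = s + l + 1 := ⟨τ - s - 1, by omega⟩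
      have hpl : γ < p l i j ω := hadj
      have h1 : p l i j ω * h i j ω ≤ ∑ l ∈ Finset.range B, ∑ i, ∑ j, p l i j ω * h i j ω := by
        refine (Finset.single_le_sum (f := fun j => p l i j ω * h i j ω)
          (fun j _ => hterm l i j) (Finset.mem_univ j)).trans ?_
        refine (Finset.single_le_sum (f := fun i => ∑ j, p l i j ω * h i j ω)
          (fun i _ => Finset.sum_nonneg fun j _ => hterm l i j) (Finset.mem_univ i)).trans ?_
        exact Finset.single_le_sum (f := fun l => ∑ i, ∑ j, p l i j ω * h i j ω)
          (fun l _ => Finset.sum_nonneg fun i _ => Finset.sum_nonneg fun j _ => hterm l i j)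
          (Finset.mem_range.2 (by omega))
      rw [norm_sub_rev, ← div_eq_inv_mul, le_div_iff₀ hγ0, mul_comm]
      exact (mul_le_mul_of_nonneg_right hpl.le (sq_nonneg _)).trans h1
  calc ∫ ω, disp (x s ω) ∂μ
      ≤ ∫ ω, (n : ℝ) ^ 3 * γ⁻¹ * ∑ l ∈ Finset.range B, ∑ i, ∑ j, p l i j ω * h i j ω ∂μ :=
        integral_mono_ae (memLp_top_integrable (memLp_top_comp_continuous continuous_disp hxs))
          (hsumi.const_mul _) hdisp
    _ = (n : ℝ) ^ 3 * γ⁻¹ * ∑ l ∈ Finset.range B, ∑ i, ∑ j, ∫ ω, p l i j ω * h i j ω ∂μ := by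
        rw [integral_const_mul, integral_finsetSum _ fun l _ => integrable_finsetSum _ fun i _ =>
          integrable_finsetSum _ fun j _ => hpi l i j]
        congr 1
        refine Finset.sum_congr rfl fun l _ => ?_
        rw [integral_finsetSum _ fun i _ => integrable_finsetSum _ fun j _ => hpi l i j]
        exact Finset.sum_congr rfl fun i _ => integral_finsetSum _ fun j _ => hpi l i j
    _ ≤ (n : ℝ) ^ 3 * γ⁻¹ * ∑ l ∈ Finset.range B, ∑ _i : Fin n, ∑ _j : Fin n, 15 * B *
          ∑ l ∈ Finset.range B, (∫ ω, edgeEnergy (W (s + l + 1) ω) (x (s + l) ω) ∂μ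
            + Λ ^ 2 * α (s + l) ^ 2) := by
        gcongr with l hl i _ j _
        exact hedge l (Finset.mem_range.1 hl) i j
    _ = _ := by
        simp only [Finset.sum_const, Finset.card_range, Finset.card_univ, Fintype.card_fin,
          nsmul_eq_mul]
        ring

lemma summable_integral_disp [NeZero n] (hx : IsSubgradientDynamics ℱ t₀ f W α x₀ x g)
    (hW : StochasticAssumption μ ℱ t₀ W) (hC : ConnectivityAssumption μ ℱ t₀ W γ)
    (hγ0 : 0 < γ) (hγ1 : γ ≤ 1) (hΛ : ∀ i z, ∀ g ∈ subgradients (f i) z, ‖g‖ ≤ Λ)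
    (hα : Summable fun k => α (t₀ + k) ^ 2) : Summable fun t => ∫ ω, disp (x t ω) ∂μ := by
  obtain ⟨B, hB, hG⟩ := hC.connected
  have hα' : Summable fun t => α t ^ 2 := by
    rw [← summable_nat_add_iff t₀]
    simpa only [add_comm] using hα
  have hle : ∀ k, t₀ ≤ k → t₀ ≤ k * B := fun k hk => hk.trans (Nat.le_mul_of_pos_right k hB)
  -- Absolute values give a nonnegative sequence at all times, including those before `t₀`, where
  -- the weights carry no sign information.
  have hE : ∀ t, t₀ ≤ t → |∫ ω, edgeEnergy (W (t + 1) ω) (x t ω) ∂μ|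
      = ∫ ω, edgeEnergy (W (t + 1) ω) (x t ω) ∂μ := fun t ht =>
    abs_of_nonneg (integral_nonneg_of_ae (by
      filter_upwards [hW.ae_row (t := t + 1) (by omega)] with ω hω using edgeEnergy_nonneg hω.1 _))
  refine summable_of_block_contraction (B := B) (k₀ := t₀)
    (S := fun t => |∫ ω, edgeEnergy (W (t + 1) ω) (x t ω) ∂μ|) (a := fun t => α t ^ 2)
    (κ := γ / 4) (C₁ := (n : ℝ) ^ 3 * γ⁻¹ * (B * n * n * (15 * B)))
    (C₂ := (n : ℝ) ^ 3 * γ⁻¹ * (B * n * n * (15 * B)) * Λ ^ 2)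
    (fun t => integral_nonneg fun ω => disp_nonneg _) (fun _ => abs_nonneg _)
    (fun _ => sq_nonneg _) hα' hB (by positivity) (by positivity) ?_ ?_
  · intro ε hε
    refine ⟨(1 + ε⁻¹) * n * Λ ^ 2, by positivity, fun t ht => ?_⟩
    have ht' : t₀ ≤ t := (hle t₀ le_rfl).trans ht
    rw [hE t ht']
    exact integral_disp_succ_le hx hW hC hγ0 hγ1 hΛ ht' hε
  · intro k hk
    refine (integral_disp_block_le hx hW hγ0 hΛ (hle k hk) (hG k hk)).trans (le_of_eq ?_)
    rw [Finset.sum_add_distrib, ← Finset.mul_sum, mul_add, mul_assoc _ (Λ ^ 2)]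
    congr 2
    exact Finset.sum_congr rfl fun l _ => (hE _ ((hle k hk).trans (Nat.le_add_right _ _))).symm

lemma ae_fejer [NeZero n] (hx : IsSubgradientDynamics ℱ t₀ f W α x₀ x g)
    (hf : ObjectiveAssumption f L)
    (hW : StochasticAssumption μ ℱ t₀ W) (hC : ConnectivityAssumption μ ℱ t₀ W γ)
    (hγ0 : 0 < γ) (hγ1 : γ ≤ 1) (hα : StepSizeAssumption t₀ α)
    {z : EuclideanSpace ℝ (Fin m)} (hz : z ∈ optimalSet f) :
    ∀ᵐ ω ∂μ, (∃ l, Tendsto (fun k => ∑ i, ‖x (t₀ + k) ω i - z‖ ^ 2) atTop (𝓝 l)) ∧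
      Summable fun k => α (t₀ + k) * (totalCost f (avg (x (t₀ + k) ω)) - totalCost f z) := by
  obtain ⟨Λ, hΛ0, hΛ⟩ := hf.exists_norm_subgradient_le
  -- Time is shifted so that index `0` corresponds to `t₀`.
  let 𝒢 : Filtration ℕ mΩ :=
    { seq := fun k => ℱ (t₀ + k)
      mono' := fun k l hkl => ℱ.mono (Nat.add_le_add_left hkl t₀)
      le' := fun k => ℱ.le _ }
  have hle : ∀ k, t₀ ≤ t₀ + k := fun k => Nat.le_add_right _ _
  have hxm : ∀ k, MemLp (x (t₀ + k)) ⊤ μ := fun k => hx.memLp hW hΛ (hle k)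
  have hxa : ∀ k, Measurable[𝒢 k] (x (t₀ + k)) := fun k => hx.measurable hW (hle k)
  have hVc : Continuous fun y : Fin n → EuclideanSpace ℝ (Fin m) => ∑ i, ‖y i - z‖ ^ 2 := by
    fun_prop
  set K : ℝ := n * (3 * Λ + Λ ^ 2) with hK
  have hK0 : 0 ≤ K := by positivity
  have hηc : ∀ k, Continuous fun y : Fin n → EuclideanSpace ℝ (Fin m) =>
      K * (α (t₀ + k) ^ 2 + disp y) := fun k =>
    continuous_const.mul (continuous_const.add continuous_disp)
  have hρc : ∀ k, Continuous fun y : Fin n → EuclideanSpace ℝ (Fin m) =>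
      2 * (α (t₀ + k) * (totalCost f (avg y) - totalCost f z)) := fun k =>
    continuous_const.mul (continuous_const.mul
      ((hf.continuous_totalCost.comp continuous_avg).sub continuous_const))
  have hVi : ∀ k, Integrable (fun ω => ∑ i, ‖x (t₀ + k) ω i - z‖ ^ 2) μ := fun k =>
    memLp_top_integrable (memLp_top_comp_continuous hVc (hxm k))
  have hρi := fun k => memLp_top_integrable (memLp_top_comp_continuous (hρc k) (hxm k))
  have hηi := fun k => memLp_top_integrable (memLp_top_comp_continuous (hηc k) (hxm k))
  have hdi : ∀ k, Integrable (fun ω => disp (x (t₀ + k) ω)) μ := fun k =>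
    memLp_top_integrable (memLp_top_comp_continuous continuous_disp (hxm k))
  have hmain := robbins_siegmund (μ := μ) (𝒢 := 𝒢)
    (V := fun k ω => ∑ i, ‖x (t₀ + k) ω i - z‖ ^ 2)
    (ρ := fun k ω => 2 * (α (t₀ + k) * (totalCost f (avg (x (t₀ + k) ω)) - totalCost f z)))
    (η := fun k ω => K * (α (t₀ + k) ^ 2 + disp (x (t₀ + k) ω)))
    (fun k ω => Finset.sum_nonneg fun _ _ => sq_nonneg _)
    (fun k ω => mul_nonneg zero_le_two
      (mul_nonneg (hα.pos _ (hle k)).le (sub_nonneg.2 (hz _))))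
    (fun k ω => mul_nonneg hK0 (add_nonneg (sq_nonneg _) (disp_nonneg _)))
    (fun k => (hVc.measurable.comp (hxa k)).stronglyMeasurable)
    (fun k => ((hηc k).measurable.comp (hxa k)).stronglyMeasurable)
    hVi hρi hηi ?_ ?_
  · filter_upwards [hmain] with ω hω
    refine ⟨hω.1, ?_⟩
    simpa [mul_assoc] using hω.2.mul_left (2⁻¹ : ℝ)
  · have hs := summable_integral_disp hx hW hC hγ0 hγ1 hΛ hα.sum_sq
    rw [← summable_nat_add_iff t₀] at hs
    simp only [add_comm _ t₀] at hs
    refine ((hα.sum_sq.add hs).mul_left K).congr fun k => ?_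
    rw [integral_const_mul, integral_add (integrable_const _) (hdi k)]
    simp
  · intro k A hA
    have ht1 : t₀ ≤ t₀ + k + 1 := by omega
    have hmixi : Integrable
        (fun ω => ∑ i, ‖(∑ j, W (t₀ + k + 1) ω i j • x (t₀ + k) ω j) - z‖ ^ 2) μ :=
      memLp_top_integrable (memLp_finsetSum _ fun i _ =>
        memLp_top_norm_sq ((hW.memLp_mix ht1 (hxm k) i).sub (memLp_const z)))
    have hVi' : Integrable (fun ω => ∑ i, ‖x (t₀ + k + 1) ω i - z‖ ^ 2) μ := hVi (k + 1)
    have h1 := hW.setIntegral_mix_le hC hγ1 (hle k) (hxa k) (hxm k)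
      (c := fun _ => z) measurable_const (memLp_const z) hA
    have hE0 : 0 ≤ ∫ ω in A, edgeEnergy (W (t₀ + k + 1) ω) (x (t₀ + k) ω) ∂μ :=
      integral_nonneg_of_ae (ae_restrict_of_ae (by
        filter_upwards [hW.ae_row ht1] with ω hω using edgeEnergy_nonneg hω.1 _))
    have h2 : ∫ ω in A, (∑ i, ‖x (t₀ + k + 1) ω i - z‖ ^ 2
        + 2 * (α (t₀ + k) * (totalCost f (avg (x (t₀ + k) ω)) - totalCost f z))) ∂μ
        ≤ ∫ ω in A, (∑ i, ‖(∑ j, W (t₀ + k + 1) ω i j • x (t₀ + k) ω j) - z‖ ^ 2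
          + K * (α (t₀ + k) ^ 2 + disp (x (t₀ + k) ω))) ∂μ := by
      refine integral_mono_ae (hVi'.add (hρi k)).integrableOn
        (hmixi.add (hηi k)).integrableOn (ae_restrict_of_ae ?_)
      filter_upwards [hW.ae_row ht1] with ω hω
      simp only [hx.step (t₀ + k) (hle k) ω]
      exact hf.sum_norm_step_sub_sq_le hΛ0 hΛ hω.1 hω.2
        (fun i => hx.subgradient (t₀ + k) (hle k) ω i) (hα.pos _ (hle k)).le z
    rw [integral_add hVi'.integrableOn (hρi k).integrableOn,
      integral_add hmixi.integrableOn (hηi k).integrableOn] at h2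
    have h3 : 0 ≤ γ / 4 * ∫ ω in A, edgeEnergy (W (t₀ + k + 1) ω) (x (t₀ + k) ω) ∂μ := by
      positivity
    rw [← add_assoc t₀ k 1]
    linarith

lemma StepSizeAssumption.not_summable (hα : StepSizeAssumption t₀ α) :
    ¬ Summable fun k => α (t₀ + k) := by
  intro h
  have h1 : ∀ T, ∑ t ∈ Finset.Ico t₀ T, α t ≤ ∑' k, α (t₀ + k) := by
    intro T
    rw [Finset.sum_Ico_eq_sum_range]
    exact h.sum_le_tsum _ fun k _ => (hα.pos _ (Nat.le_add_right _ _)).le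
  obtain ⟨T, hT⟩ := (hα.sum_eq_top.eventually_gt_atTop (∑' k, α (t₀ + k))).exists
  exact absurd (h1 T) (not_le.2 hT)

end Dynamics

end DistOpt

theorem theorem1 {n m : ℕ} {Ω : Type*} [mΩ : MeasurableSpace Ω] (μ : Measure Ω)
    [IsProbabilityMeasure μ] (ℱ : Filtration ℕ mΩ) (t₀ : ℕ) (ht₀ : 1 ≤ t₀)
    (f : Fin n → EuclideanSpace ℝ (Fin m) → ℝ) (L : Fin n → ℝ)
    (W : ℕ → Ω → Matrix (Fin n) (Fin n) ℝ) (γ : ℝ) (hγ : 0 < γ ∧ γ < 1) (α : ℕ → ℝ)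
    (hf : DistOpt.ObjectiveAssumption f L)
    (hW : DistOpt.StochasticAssumption μ ℱ t₀ W)
    (hC : DistOpt.ConnectivityAssumption μ ℱ t₀ W γ)
    (hα : DistOpt.StepSizeAssumption t₀ α)
    (x₀ : Fin n → EuclideanSpace ℝ (Fin m))
    (x g : ℕ → Ω → Fin n → EuclideanSpace ℝ (Fin m))
    (hx : DistOpt.IsSubgradientDynamics ℱ t₀ f W α x₀ x g) :
    ∃ z : Ω → EuclideanSpace ℝ (Fin m), Measurable z ∧
      (∀ᵐ ω ∂μ, z ω ∈ DistOpt.optimalSet f) ∧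
      ∀ᵐ ω ∂μ, ∀ i, Tendsto (fun t => x t ω i) atTop (𝓝 (z ω)) := by
  obtain ⟨B, hB, hG⟩ := hC.connected
  -- A root is a vertex, so there is at least one agent.
  have : NeZero n := by
    obtain ⟨ω, r, -⟩ := (hG t₀ le_rfl).exists
    exact ⟨fun h => (Nat.not_lt_zero r.1) (h ▸ r.2)⟩
  obtain ⟨Λ, hΛ0, hΛ⟩ := hf.exists_norm_subgradient_le
  obtain ⟨z₀, hz₀⟩ := hf.nonempty_optimalSet
  -- The exceptional null set in `ae_fejer` depends on the minimizer; countability of `D` allows a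
  -- common one.
  obtain ⟨D, hDZ, hDc, hD⟩ := (TopologicalSpace.IsSeparable.of_separableSpace
    (DistOpt.optimalSet f)).exists_countable_dense_subset
  have hdisp : ∀ᵐ ω ∂μ, Summable fun k => DistOpt.disp (x (t₀ + k) ω) := by
    refine DistOpt.ae_summable_of_summable_integral (fun k ω => DistOpt.disp_nonneg _) (fun k =>
      DistOpt.memLp_top_integrable (DistOpt.memLp_top_comp_continuous DistOpt.continuous_disp
        (hx.memLp hW hΛ (Nat.le_add_right _ _)))) ?_
    have hs := DistOpt.summable_integral_disp hx hW hC hγ.1 hγ.2.le hΛ hα.sum_sq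
    rw [← summable_nat_add_iff t₀] at hs
    simpa only [add_comm _ t₀] using hs
  have hfejer : ∀ᵐ ω ∂μ, ∀ z ∈ D,
      ∃ l, Tendsto (fun k => ∑ i, ‖x (t₀ + k) ω i - z‖ ^ 2) atTop (𝓝 l) :=
    (ae_ball_iff hDc).2 fun z hz =>
      (DistOpt.ae_fejer hx hf hW hC hγ.1 hγ.2.le hα (hDZ hz)).mono fun _ h => h.1
  have hlim : ∀ᵐ ω ∂μ, ∃ z ∈ DistOpt.optimalSet f,
      ∀ i, Tendsto (fun k => x (t₀ + k) ω i) atTop (𝓝 z) := by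
    filter_upwards [hdisp, hfejer, DistOpt.ae_fejer hx hf hW hC hγ.1 hγ.2.le hα hz₀]
      with ω h1 h2 h3
    exact DistOpt.exists_tendsto_minimizer hf.continuous_totalCost (fun _ => Iff.rfl)
      hf.nonempty_optimalSet hD h2 h1.tendsto_atTop_zero
      (fun k => hα.pos _ (Nat.le_add_right _ _)) hα.not_summable hz₀ h3.2
  -- The pointwise limits are chosen separately for each `ω`; a measurable version is recovered as
  -- the limit of agent `0`.
  obtain ⟨z, hzm, hz⟩ := measurable_limit_of_tendsto_metrizable_ae (μ := μ) (L := atTop)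
    (f := fun k ω => x (t₀ + k) ω 0) (fun k => (((measurable_pi_apply 0).comp
      (hx.measurable hW (Nat.le_add_right t₀ k))).mono (ℱ.le _) le_rfl).aemeasurable)
    (hlim.mono fun ω ⟨y, _, hy⟩ => ⟨y, hy 0⟩)
  have hboth : ∀ᵐ ω ∂μ, z ω ∈ DistOpt.optimalSet f ∧
      ∀ i, Tendsto (fun t => x t ω i) atTop (𝓝 (z ω)) := by
    filter_upwards [hlim, hz] with ω ⟨y, hyZ, hy⟩ hzω
    obtain rfl := tendsto_nhds_unique hzω (hy 0)
    refine ⟨hyZ, fun i => ?_⟩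
    rw [← tendsto_add_atTop_iff_nat t₀]
    simpa only [add_comm _ t₀] using hy i
  exact ⟨z, hzm, hboth.mono fun _ h => h.1, hboth.mono fun _ h => h.2⟩
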